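/- Let $n\ge 2$, $s\in[0,1]$, let $U:\mathbb{R}\to\mathbb{R}$ be differentiable on $(0,\infty)$, and let $u(x)=U(|x|)$, $x\in\mathbb{R}^n$, be the corresponding radial function. Put $$v=-2su+ru',\qquad\text{i.e. } v(x)=-2s\,U(|x|)+|x|\,U'(|x|),$$ and assume that $$\int_{\mathbb{R}^n}\frac{|u(x)|}{(1+|x|^2)^{\frac{n+2s}{2}}}\,dx<\infty,\qquad \int_{\mathbb{R}^n}\frac{|v(x)|}{(1+|x|^2)^{\frac{n+2s}{2}}}\,dx<\infty ,$$ so that both $(-\Delta)^su$ and $(-\Delta)^sv$ are defined. Here, for $0<s<1$, $$(-\Delta)^sw(x)=c_{s,n}\,\mathrm{p.v.}\!\int_{\mathbb{R}^n}\frac{w(x)-w(y)}{|x-y|^{n+2s}}\,dy,\qquad c_{s,n}=\frac{4^s\,s\,\Gamma(\frac n2+s)}{\pi^{n/2}\,\Gamma(1-s)},$$ $(-\Delta)^0w=w$, $(-\Delta)^1w=-\Delta w$, and in the sense of distributions $\langle(-\Delta)^sw,h\rangle=\int_{\mathbb{R}^n}w\,(-\Delta)^sh\,dx$ for $h\in C_0^\infty(\mathbb{R}^n)$.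 Then $$\frac{d}{dr}(-\Delta)^su=\frac1r\,(-\Delta)^s(-2su+ru')$$ in the following senses. (1) In $\mathcal{D}'(\mathbb{R}^n\setminus\{0\})$, where $\frac{d}{dr}=\frac{x}{|x|}\cdot\nabla$: the integrals defining $\langle(-\Delta)^su,h\rangle$ and $\langle(-\Delta)^sv,h\rangle$ converge absolutely for all $h\in C_0^\infty(\mathbb{R}^n)$, and for all $h\in C_0^\infty(\mathbb{R}^n\setminus\{0\})$ $$-\Big\langle(-\Delta)^su,\ \operatorname{div}\Big(h\,\frac{x}{|x|}\Big)\Big\rangle=\Big\langle(-\Delta)^sv,\ \frac{h}{|x|}\Big\rangle .$$ (2) Pointwise at every $r>0$ such that $U$ is of class $C^3$ near $r$ (at every $r>0$ if $s=0$): $(-\Delta)^su(x)$ exists and depends only on $|x|$ for $|x|$ near $r$, $(-\Delta)^sv(x)$ exists and depends only on $|x|$ for $|x|=r$, the function $\rho\mapsto(-\Delta)^su(\rho)$ is differentiable at $r$, and $$\frac{d(-\Delta)^su}{dr}(r)=\frac1r\,(-\Delta)^s(-2su+ru')(r).$$ -/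

import Mathlib

open scoped ContDiff

noncomputable section

namespace FracLap

/-- `ℝⁿ` with the Euclidean norm. -/
abbrev E (n : ℕ) : Type := EuclideanSpace ℝ (Fin n)

/-- The radial function on `ℝⁿ` with profile `U`. -/
def radial {n : ℕ} (U : ℝ → ℝ) : E n → ℝ := fun x => U ‖x‖

/-- The weighted integrability condition `∫ |u(x)| (1 + |x|²)^(-(n+2s)/2) dx < ∞`
(with measurability of `u`; the weight is continuous and positive, so `u` is then
locally integrable). -/
def WeightedIntegrable {n : ℕ} (s : ℝ) (u : E n → ℝ) : Prop :=
  MeasureTheory.Integrable (fun x : E n => u x / (1 + ‖x‖ ^ 2) ^ (((n : ℝ) + 2 * s) / 2))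

/-- The usual normalization constant
`c_{s,n} = 4^s s Γ(n/2 + s) / (π^(n/2) Γ(1 - s))`, positive for `0 < s < 1`. -/
def normConst (s : ℝ) (n : ℕ) : ℝ :=
  4 ^ s * s * Real.Gamma ((n : ℝ) / 2 + s) / (Real.pi ^ ((n : ℝ) / 2) * Real.Gamma (1 - s))

/-- The truncated singular integral
`c_{s,n} ∫_{|x-y|>ε} (u(x) - u(y)) / |x-y|^(n+2s) dy`. -/
def truncated {n : ℕ} (s : ℝ) (u : E n → ℝ) (x : E n) (ε : ℝ) : ℝ :=
  normConst s n *
    ∫ y in {y : E n | ε < ‖x - y‖}, (u x - u y) / ‖x - y‖ ^ ((n : ℝ) + 2 * s)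

/-- `HasFracLapAt s u x L`: the pointwise value `(-Δ)^s u(x)` is defined and equals `L`.
For `0 < s < 1` it is the principal value of the singular integral (which is the Lebesgue
integral whenever that converges); `(-Δ)^0` is the identity and `(-Δ)^1 = -Δ`. -/
def HasFracLapAt {n : ℕ} (s : ℝ) (u : E n → ℝ) (x : E n) (L : ℝ) : Prop :=
  (s = 0 ∧ L = u x) ∨
  (s = 1 ∧ ContDiffAt ℝ 2 u x ∧ L = -(Laplacian.laplacian u x)) ∨
  ((0 < s ∧ s < 1) ∧
    (∀ ε > 0, MeasureTheory.IntegrableOn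
      (fun y : E n => (u x - u y) / ‖x - y‖ ^ ((n : ℝ) + 2 * s)) {y : E n | ε < ‖x - y‖}) ∧
    Filter.Tendsto (truncated s u x) (nhdsWithin 0 (Set.Ioi 0)) (nhds L))

/-- The value is unique. -/
theorem HasFracLapAt.unique {n : ℕ} {s : ℝ} {u : E n → ℝ} {x : E n} {L L' : ℝ}
    (h : HasFracLapAt s u x L) (h' : HasFracLapAt s u x L') : L = L' := by
  rcases h with ⟨h0, h⟩ | ⟨h0, _, h⟩ | ⟨h0, _, h⟩ <;>
  rcases h' with ⟨h0', h'⟩ | ⟨h0', _, h'⟩ | ⟨h0', _, h'⟩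
  · rw [h, h']
  · linarith
  · linarith [h0'.1]
  · linarith
  · rw [h, h']
  · linarith [h0'.2]
  · linarith [h0.1]
  · linarith [h0.2]
  · exact tendsto_nhds_unique h h'

open Classical in
/-- The function `(-Δ)^s u`, equal to `0` at points where the pointwise value does not exist
(for test functions `u` and `0 ≤ s ≤ 1` it exists everywhere). -/
def fracLap {n : ℕ} (s : ℝ) (u : E n → ℝ) (x : E n) : ℝ :=
  if h : ∃ L, HasFracLapAt s u x L then h.choose else 0

/-- Test functions on the open set `Ω`. -/
def IsTest {n : ℕ} (Ω : Set (E n)) (h : E n → ℝ) : Prop :=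
  ContDiff ℝ ∞ h ∧ HasCompactSupport h ∧ tsupport h ⊆ Ω

/-- The distribution `(-Δ)^s u`: `⟨(-Δ)^s u, h⟩ = ∫ u (-Δ)^s h dx`. -/
def distFracLap {n : ℕ} (s : ℝ) (u : E n → ℝ) : (E n → ℝ) → ℝ :=
  fun h => ∫ x : E n, u x * fracLap s h x

/-- The pairing defining the distribution `(-Δ)^s u` on `ℝⁿ` converges absolutely
for every test function. -/
def DistFracLapDefined {n : ℕ} (s : ℝ) (u : E n → ℝ) : Prop :=
  ∀ h : E n → ℝ, IsTest Set.univ h → MeasureTheory.Integrable (fun x : E n => u x * fracLap s h x)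

/-- The divergence of a vector field. -/
def div {n : ℕ} (F : E n → E n) (x : E n) : ℝ :=
  ∑ i : Fin n, fderiv ℝ F x (EuclideanSpace.single i 1) i

/-- The radial derivative `d/dr = (x/|x|) · ∇` of a distribution `T` on `ℝⁿ \ {0}`, by duality:
`⟨dT/dr, h⟩ = -⟨T, div (h x/|x|)⟩`. -/
def distRadialDeriv {n : ℕ} (T : (E n → ℝ) → ℝ) : (E n → ℝ) → ℝ :=
  fun h => -T (div fun x => (h x / ‖x‖) • x)

/-- The product `(1/r) T` of a distribution `T` on `ℝⁿ \ {0}` and the smooth function `1/|x|`. -/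
def distDivRadius {n : ℕ} (T : (E n → ℝ) → ℝ) : (E n → ℝ) → ℝ :=
  fun h => T fun x => h x / ‖x‖

end FracLap

end

namespace FracLap

open MeasureTheory Set Filter Topology

/-! The operator `(-Δ)^s` is homogeneous of degree `2s` under dilations. Differentiating this
scaling law at `t = 1` gives `x·∇(-Δ)^s g = (-Δ)^s(x·∇g) - 2s(-Δ)^s g`, which for radial `g` is the
claimed formula. For compactly supported `C³` functions this is `hasDerivAt_fracLap_ray`. The rest
transfers it to `u`, which is only differentiable along rays and may be singular at the origin.

The tool for the transfer is `integral_euler`: `∫ x·∇f = -n ∫ f` as soon as `f` and its ray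
derivative are integrable.

Distributions: with `g = h/|x|`, apply it to `f = u (-Δ)^s g`. The terms `±2s u (-Δ)^s g` cancel,
and `div(g x) = n g + x·∇g` gives the identity. Integrability comes from the decay `|(-Δ)^s g| ≤ C
(1+|x|²)^(-(n+2s)/2)`.

Pointwise, `0 < s < 1`: split `u = g + w` with `g` of class `C³` and compactly supported, and `w`
vanishing near the point. The commutation rule handles `g`. For `w` the integral is nonsingular:
differentiate the kernel under the integral sign, then use `integral_euler` to move the derivative
onto `w` (`hasDerivAt_integral_kernel`). For `s = 1` everything is local and follows from `[Δ, x·∇]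
= 2Δ`; for `s = 0` the formula is `U' = (1/r)(r U')`. -/

/-! ### Integrals of ray derivatives. -/

theorem quasiMeasurePreserving_smul {n : ℕ} {I : Set ℝ} (hI : ∀ t ∈ I, t ≠ 0)
    (hIm : MeasurableSet I) :
    Measure.QuasiMeasurePreserving (fun q : ℝ × E n => q.1 • q.2)
      ((volume.restrict I).prod volume) volume := by
  have hm : Measurable (fun q : ℝ × E n => q.1 • q.2) := by fun_prop
  refine ⟨hm, ?_⟩
  refine Measure.AbsolutelyContinuous.mk fun N hN h0 => ?_
  rw [Measure.map_apply hm hN, Measure.measure_prod_null (hm hN)]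
  filter_upwards [ae_restrict_mem hIm] with t ht
  have : Prod.mk t ⁻¹' ((fun q : ℝ × E n => q.1 • q.2) ⁻¹' N) = (fun x : E n => t • x) ⁻¹' N := rfl
  rw [this, Measure.addHaar_preimage_smul _ (hI t ht), h0]
  simp

/-- Ray derivatives are recorded only at parameter `1`; rescaling the parameter recovers them at
every other point of the ray. -/
theorem hasDerivAt_ray {n : ℕ} {f f' : E n → ℝ} {x : E n} {t : ℝ} (ht : t ≠ 0)
    (h : HasDerivAt (fun a : ℝ => f (a • t • x)) (f' (t • x)) 1) :
    HasDerivAt (fun a : ℝ => f (a • x)) (f' (t • x) / t) t := by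
  have h1 : HasDerivAt (fun a : ℝ => a / t) (1 / t) t := (hasDerivAt_id t).div_const t
  have h2 : HasDerivAt (fun a : ℝ => f (a • t • x)) (f' (t • x)) (t / t) := by
    rwa [div_self ht]
  have h3 := HasDerivAt.comp (h := fun a : ℝ => a / t) t h2 h1
  refine (h3.congr_deriv (by ring)).congr_of_eventuallyEq (Eventually.of_forall fun a => ?_)
  simp [smul_smul, div_mul_cancel₀ a ht]

/-- The integral of the radial derivative `x · ∇f`. -/
theorem integral_euler {n : ℕ} (hn : n ≠ 0) {f f' : E n → ℝ} (hf : Integrable f)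
    (hf' : Integrable f') (h : ∀ x ≠ 0, HasDerivAt (fun t : ℝ => f (t • x)) (f' x) 1) :
    ∫ x, f' x = -n * ∫ x, f x := by
  have : Nonempty (Fin n) := ⟨⟨0, Nat.pos_of_ne_zero hn⟩⟩
  have hpos : ∀ t ∈ Ioc (1 : ℝ) 2, t ≠ 0 := fun t ht => by linarith [ht.1]
  have hfd : Module.finrank ℝ (E n) = n := by simp
  have hscale : ∀ (k : E n → ℝ) (t : ℝ), t ∈ Ioc (1 : ℝ) 2 →
      ∫ x, k (t • x) / t = t ^ (-(n : ℤ) - 1) * ∫ x, k x := by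
    intro k t ht
    have ht0 : 0 < t := by linarith [ht.1]
    rw [integral_div, Measure.integral_comp_smul, hfd, abs_of_pos (by positivity), smul_eq_mul,
      zpow_sub₀ ht0.ne', zpow_neg, zpow_natCast, zpow_one]
    ring
  have hJ : Integrable (fun q : ℝ × E n => f' (q.1 • q.2) / q.1)
      ((volume.restrict (Ioc (1 : ℝ) 2)).prod volume) := by
    have hae : AEStronglyMeasurable (fun q : ℝ × E n => f' (q.1 • q.2) / q.1)
        ((volume.restrict (Ioc (1 : ℝ) 2)).prod volume) := by
      simp only [div_eq_mul_inv]
      exact (hf'.aestronglyMeasurable.comp_quasiMeasurePreserving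
        (quasiMeasurePreserving_smul hpos measurableSet_Ioc)).mul
        measurable_fst.inv.aestronglyMeasurable
    rw [integrable_prod_iff hae]
    constructor
    · filter_upwards [ae_restrict_mem measurableSet_Ioc] with t ht
      exact (hf'.comp_smul (hpos t ht)).div_const t
    · have : IntegrableOn (fun t : ℝ => t ^ (-(n : ℤ) - 1) * ∫ x, ‖f' x‖) (Ioc 1 2) := by
        refine IntegrableOn.mono_set (ContinuousOn.integrableOn_Icc ?_) Ioc_subset_Icc_self
        refine ContinuousOn.mul (continuousOn_id.zpow₀ _ fun t ht => Or.inl ?_) continuousOn_const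
        have := ht.1
        simp only [id]; linarith
      refine this.congr_fun (fun t ht => ?_) measurableSet_Ioc
      have ht0 : 0 < t := by linarith [ht.1]
      simp only [norm_div, Real.norm_of_nonneg ht0.le]
      exact (hscale (fun x => ‖f' x‖) t ht).symm
  have hx0 : ∀ᵐ x : E n, x ≠ 0 := by
    simp [ae_iff, measure_singleton]
  -- Comparing `f(2x)` with `f(x)` avoids cutoffs at infinity and at the origin. By scaling, the
  -- left side is `(2^(-n) - 1) ∫ f`; after Fubini the right side is `(∫₁² t^(-n-1) dt) ∫ f' = ((1 -
  -- 2^(-n))/n) ∫ f'`.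
  have key : ∫ x, (f ((2 : ℝ) • x) - f x) = ∫ x, ∫ t in Ioc (1 : ℝ) 2, f' (t • x) / t := by
    refine integral_congr_ae ?_
    filter_upwards [hx0, hJ.prod_left_ae] with x hx hxi
    have := intervalIntegral.integral_eq_sub_of_hasDerivAt (a := 1) (b := 2)
      (f := fun a : ℝ => f (a • x)) (f' := fun t => f' (t • x) / t) (fun t ht => ?_) ?_
    · rw [← intervalIntegral.integral_of_le one_le_two, this]; simp
    · rw [uIcc_of_le one_le_two] at ht
      have ht0 : t ≠ 0 := by linarith [ht.1]
      exact hasDerivAt_ray ht0 (h (t • x) (smul_ne_zero ht0 hx))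
    · rw [intervalIntegrable_iff_integrableOn_Ioc_of_le one_le_two]
      exact hxi
  have hsw := integral_integral_swap (f := fun (t : ℝ) (x : E n) => f' (t • x) / t) hJ
  rw [integral_sub (hf.comp_smul two_ne_zero) hf, Measure.integral_comp_smul, hfd, ← hsw,
    setIntegral_congr_fun measurableSet_Ioc (fun t ht => hscale f' t ht), integral_mul_const,
    ← intervalIntegral.integral_of_le one_le_two, integral_zpow, abs_of_pos (by positivity)] at key
  · have hn' : (n : ℝ) ≠ 0 := by exact_mod_cast hn
    have h2 : ((2 : ℝ) ^ n)⁻¹ - 1 ≠ 0 := by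
      have : (2 : ℝ) ^ n > 1 := one_lt_pow₀ one_lt_two hn
      have := inv_lt_one_of_one_lt₀ this
      linarith
    simp only [smul_eq_mul, sub_add_cancel, zpow_neg, zpow_natCast, one_pow, inv_one] at key
    push_cast at key
    apply mul_left_cancel₀ h2
    have e : (-(n : ℝ) - 1 + 1) = -n := by ring
    rw [e] at key
    field_simp at key
    field_simp
    linarith
  · right
    refine ⟨by omega, ?_⟩
    rw [uIcc_of_le one_le_two]
    simp

/-! ### Linearity of the pointwise operator. -/

theorem HasFracLapAt.fracLap_eq {n : ℕ} {s : ℝ} {u : E n → ℝ} {x : E n} {L : ℝ}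
    (h : HasFracLapAt s u x L) : fracLap s u x = L := by
  have hex : ∃ L, HasFracLapAt s u x L := ⟨L, h⟩
  rw [fracLap, dif_pos hex]
  exact hex.choose_spec.unique h

theorem HasFracLapAt.add {n : ℕ} {s : ℝ} {u w : E n → ℝ} {x : E n} {L M : ℝ}
    (h : HasFracLapAt s u x L) (k : HasFracLapAt s w x M) :
    HasFracLapAt s (fun y => u y + w y) x (L + M) := by
  rcases h with ⟨h0, h⟩ | ⟨h0, hc, h⟩ | ⟨h0, hi, h⟩ <;>
  rcases k with ⟨k0, k⟩ | ⟨k0, kc, k⟩ | ⟨k0, ki, k⟩ <;>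
  try (exfalso; first | linarith | linarith [h0.1, h0.2] | linarith [k0.1, k0.2])
  · exact Or.inl ⟨h0, by rw [h, k]⟩
  · refine Or.inr (Or.inl ⟨h0, hc.add kc, ?_⟩)
    have := hc.laplacian_add kc
    rw [h, k, ← neg_add, ← this]
    rfl
  · refine Or.inr (Or.inr ⟨h0, fun ε hε => ?_, ?_⟩)
    · refine ((hi ε hε).add (ki ε hε)).congr (Eventually.of_forall fun y => ?_)
      simp only [Pi.add_apply]; ring
    · refine (h.add k).congr' ?_
      filter_upwards [self_mem_nhdsWithin] with ε hε
      rw [truncated, truncated, truncated, ← mul_add, ← integral_add (hi ε hε) (ki ε hε)]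
      congr 2
      ext y
      ring

theorem HasFracLapAt.const_mul {n : ℕ} {s : ℝ} {u : E n → ℝ} {x : E n} {L : ℝ} (a : ℝ)
    (h : HasFracLapAt s u x L) : HasFracLapAt s (fun y => a * u y) x (a * L) := by
  rcases h with ⟨h0, h⟩ | ⟨h0, hc, h⟩ | ⟨h0, hi, h⟩
  · exact Or.inl ⟨h0, by rw [h]⟩
  · refine Or.inr (Or.inl ⟨h0, contDiffAt_const.mul hc, ?_⟩)
    have := InnerProductSpace.laplacian_smul a hc
    rw [h, mul_neg, ← smul_eq_mul, ← this]
    rfl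
  · refine Or.inr (Or.inr ⟨h0, fun ε hε => ?_, ?_⟩)
    · refine ((hi ε hε).const_mul a).congr (Eventually.of_forall fun y => ?_)
      ring
    · refine (h.const_mul a).congr fun ε => ?_
      rw [truncated, truncated, mul_left_comm, ← integral_const_mul]
      congr 2
      ext y
      ring

theorem HasFracLapAt.congr_of_eq {n : ℕ} {s : ℝ} {u w : E n → ℝ} {x : E n} {L : ℝ}
    (h : HasFracLapAt s u x L) (huw : ∀ y, w y = u y) : HasFracLapAt s w x L := by
  rwa [funext huw]

/-! ### Second differences, which absorb the singularity of the kernel. -/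

/-- The second difference `2g(x) - g(x+y) - g(x-y)`. -/
def secondDiff {n : ℕ} (g : E n → ℝ) (x y : E n) : ℝ := 2 * g x - g (x + y) - g (x - y)

theorem integrable_min_kernel {n : ℕ} (hn : n ≠ 0) {s : ℝ} (hs : 0 < s) (hs1 : s < 1) :
    Integrable (fun y : E n => min 1 (‖y‖ ^ 2) / ‖y‖ ^ ((n : ℝ) + 2 * s)) := by
  have : Nonempty (Fin n) := ⟨⟨0, Nat.pos_of_ne_zero hn⟩⟩
  have hn1 : 1 ≤ n := Nat.one_le_iff_ne_zero.mpr hn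
  rw [integrable_fun_norm_addHaar (volume : Measure (E n))
    (f := fun r : ℝ => min 1 (r ^ 2) / r ^ ((n : ℝ) + 2 * s)), ← Ioc_union_Ioi_eq_Ioi zero_le_one]
  have hpow : ∀ r : ℝ, 0 < r → r ^ (Module.finrank ℝ (E n) - 1) = r ^ ((n : ℝ) - 1) := by
    intro r hr
    rw [finrank_euclideanSpace_fin, ← Real.rpow_natCast, Nat.cast_sub hn1, Nat.cast_one]
  refine IntegrableOn.union ?_ ?_
  · have : IntegrableOn (fun r : ℝ => r ^ (1 - 2 * s)) (Ioc 0 1) := by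
      rw [← intervalIntegrable_iff_integrableOn_Ioc_of_le zero_le_one]
      exact intervalIntegral.intervalIntegrable_rpow' (by linarith)
    refine this.congr_fun (fun r hr => ?_) measurableSet_Ioc
    have h1 : r ^ 2 ≤ 1 := by nlinarith [hr.1, hr.2]
    simp only [smul_eq_mul]
    rw [hpow r hr.1, min_eq_right h1, ← Real.rpow_natCast r 2, ← Real.rpow_sub hr.1,
      ← Real.rpow_add hr.1]
    congr 1
    push_cast; ring
  · have : IntegrableOn (fun r : ℝ => r ^ (-1 - 2 * s)) (Ioi 1) :=
      integrableOn_Ioi_rpow_of_lt (by linarith) one_pos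
    refine this.congr_fun (fun r hr => ?_) measurableSet_Ioi
    have hr0 : 0 < r := one_pos.trans hr
    have h1 : 1 ≤ r ^ 2 := one_le_pow₀ (le_of_lt hr)
    simp only [smul_eq_mul]
    rw [hpow r hr0, min_eq_left h1, one_div, ← Real.rpow_neg hr0.le, ← Real.rpow_add hr0]
    congr 1
    ring

theorem secondDiff_bound {n : ℕ} {g : E n → ℝ} (hg : ContDiff ℝ 2 g) (hc : HasCompactSupport g) :
    ∃ C, 0 ≤ C ∧ ∀ x y, |secondDiff g x y| ≤ C * min 1 (‖y‖ ^ 2) := by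
  obtain ⟨M, hM⟩ := hc.exists_bound_of_continuous hg.continuous
  have hM0 : 0 ≤ M := (norm_nonneg _).trans (hM 0)
  have hg' : ContDiff ℝ 1 (fderiv ℝ g) := hg.fderiv_right (by norm_num)
  obtain ⟨K, hK⟩ := hg'.lipschitzWith_of_hasCompactSupport (hc.fderiv ℝ) (by norm_num)
  -- `4M` bounds the four values of `g`. `2K` comes from the mean value inequality, since `∇g(x+z) -
  -- ∇g(x-z)` has norm at most `2K|z|`.
  refine ⟨max (4 * M) (2 * K), by positivity, fun x y => ?_⟩
  rw [mul_min_of_nonneg _ _ (by positivity)]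
  refine le_min ?_ ?_
  · have h1 := abs_le.mp (hM x)
    have h2 := abs_le.mp (hM (x + y))
    have h3 := abs_le.mp (hM (x - y))
    refine le_trans ?_ ((le_max_left _ _).trans (mul_one _).ge)
    rw [secondDiff, abs_le]
    constructor <;> linarith [h1.1, h1.2, h2.1, h2.2, h3.1, h3.2]
  · have hd : Differentiable ℝ g := hg.differentiable (by norm_num)
    have hF : ∀ z, HasFDerivAt (fun z => g (x + z) + g (x - z))
        (fderiv ℝ g (x + z) - fderiv ℝ g (x - z)) z := by
      intro z
      have h1 : HasFDerivAt (fun z => g (x + z)) (fderiv ℝ g (x + z)) z := by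
        have := (hd (x + z)).hasFDerivAt.comp z ((hasFDerivAt_id z).const_add x)
        simpa [Function.comp_def] using this
      have h2 : HasFDerivAt (fun z => g (x - z)) (-fderiv ℝ g (x - z)) z := by
        have := (hd (x - z)).hasFDerivAt.comp z ((hasFDerivAt_id z).const_sub x)
        simpa [Function.comp_def] using this
      rw [sub_eq_add_neg]
      exact h1.add h2
    have hb : ∀ z ∈ Metric.closedBall (0 : E n) ‖y‖,
        ‖fderiv ℝ g (x + z) - fderiv ℝ g (x - z)‖ ≤ 2 * K * ‖y‖ := by
      intro z hz
      rw [mem_closedBall_zero_iff] at hz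
      have := hK.dist_le_mul (x + z) (x - z)
      rw [dist_eq_norm, dist_eq_norm, show x + z - (x - z) = (2 : ℝ) • z by
        rw [two_smul]; abel, norm_smul, Real.norm_two] at this
      have hK0 : (0 : ℝ) ≤ K := K.2
      nlinarith
    have := (convex_closedBall (0 : E n) ‖y‖).norm_image_sub_le_of_norm_hasFDerivWithin_le
      (fun z _ => (hF z).hasFDerivWithinAt) hb (x := 0) (y := y) (by simp) (by simp)
    simp only [add_zero, sub_zero] at this
    have e : |secondDiff g x y| = ‖g (x + y) + g (x - y) - (g x + g x)‖ := by
      rw [secondDiff, Real.norm_eq_abs, ← abs_neg]; congr 1; ring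
    rw [e]
    refine this.trans ?_
    rw [mul_assoc, ← pow_two]
    gcongr
    exact le_max_right _ _

theorem continuous_secondDiff {n : ℕ} {g : E n → ℝ} (hg : Continuous g) :
    Continuous fun q : E n × E n => secondDiff g q.1 q.2 := by
  unfold secondDiff
  fun_prop

theorem measurable_secondDiff_kernel {n : ℕ} {g : E n → ℝ} (hg : Continuous g) (p : ℝ) :
    Measurable fun q : E n × E n => secondDiff g q.1 q.2 / ‖q.2‖ ^ p :=
  (continuous_secondDiff hg).measurable.div (by fun_prop)

theorem norm_secondDiff_kernel_le {n : ℕ} {g : E n → ℝ} {C : ℝ} {x y : E n} {p : ℝ}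
    (hC : |secondDiff g x y| ≤ C * min 1 (‖y‖ ^ 2)) :
    ‖secondDiff g x y / ‖y‖ ^ p‖ ≤ C * (min 1 (‖y‖ ^ 2) / ‖y‖ ^ p) := by
  have : 0 ≤ ‖y‖ ^ p := by positivity
  rw [norm_div, Real.norm_eq_abs, Real.norm_of_nonneg this, ← mul_div_assoc]
  gcongr

theorem integrable_secondDiff {n : ℕ} (hn : n ≠ 0) {s : ℝ} (hs : 0 < s) (hs1 : s < 1)
    {g : E n → ℝ} (hg : ContDiff ℝ 2 g) (hc : HasCompactSupport g) (x : E n) :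
    Integrable fun y : E n => secondDiff g x y / ‖y‖ ^ ((n : ℝ) + 2 * s) := by
  obtain ⟨C, -, hC⟩ := secondDiff_bound hg hc
  refine ((integrable_min_kernel hn hs hs1).const_mul C).mono' ?_
    (Eventually.of_forall fun y => norm_secondDiff_kernel_le (hC x y))
  exact ((measurable_secondDiff_kernel hg.continuous _).comp
    measurable_prodMk_left).aestronglyMeasurable

/-! ### The weight and the kernel away from its singularity. -/

theorem inv_norm_sub_rpow_le {n : ℕ} {p δ R : ℝ} (hp : 0 ≤ p) (hδ : 0 < δ) :
    ∃ C, 0 ≤ C ∧ ∀ x y : E n, ‖x‖ ≤ R → δ ≤ ‖x - y‖ →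
      (‖x - y‖ ^ p)⁻¹ ≤ C * ((1 + ‖y‖ ^ 2) ^ (p / 2))⁻¹ := by
  -- The constant comes from `1 + |y|² ≤ 1 + 2R² + 2|x-y|²`, with `1 + 2R²` multiplied by `|x-y|²/δ²
  -- ≥ 1`.
  refine ⟨((1 + 2 * R ^ 2) / δ ^ 2 + 2) ^ (p / 2), by positivity, fun x y hx hy => ?_⟩
  have hpos : 0 < ‖x - y‖ := hδ.trans_le hy
  have hy2 : 1 + ‖y‖ ^ 2 ≤ ((1 + 2 * R ^ 2) / δ ^ 2 + 2) * ‖x - y‖ ^ 2 := by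
    have h1 : ‖y‖ ≤ ‖x‖ + ‖x - y‖ := by
      have := norm_sub_le x (x - y)
      simpa using this
    have h2 : 1 ≤ ‖x - y‖ ^ 2 / δ ^ 2 := by
      rw [one_le_div (by positivity)]; gcongr
    have h3 : ‖y‖ ^ 2 ≤ 2 * ‖x‖ ^ 2 + 2 * ‖x - y‖ ^ 2 := by
      nlinarith [sq_nonneg (‖x‖ - ‖x - y‖), norm_nonneg y]
    have h4 : ‖x‖ ^ 2 ≤ R ^ 2 := by gcongr
    have h5 : (1 + 2 * R ^ 2) * 1 ≤ (1 + 2 * R ^ 2) * (‖x - y‖ ^ 2 / δ ^ 2) := by gcongr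
    have h6 : ((1 + 2 * R ^ 2) / δ ^ 2 + 2) * ‖x - y‖ ^ 2 =
      (1 + 2 * R ^ 2) * (‖x - y‖ ^ 2 / δ ^ 2) + 2 * ‖x - y‖ ^ 2 := by ring
    linarith
  have h7 : (1 + ‖y‖ ^ 2) ^ (p / 2) ≤ ((1 + 2 * R ^ 2) / δ ^ 2 + 2) ^ (p / 2) * ‖x - y‖ ^ p := by
    refine (Real.rpow_le_rpow (by positivity) hy2 (by positivity)).trans_eq ?_
    rw [Real.mul_rpow (by positivity) (by positivity), ← Real.rpow_natCast ‖x - y‖ 2,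
      ← Real.rpow_mul (norm_nonneg _)]
    congr 2
    push_cast; ring
  rw [inv_le_iff_one_le_mul₀ (by positivity), mul_assoc, mul_comm, mul_assoc,
    ← div_eq_inv_mul, one_le_div (by positivity), mul_comm]
  exact h7

theorem measurable_weight {n : ℕ} (p : ℝ) :
    Measurable fun y : E n => (1 + ‖y‖ ^ 2) ^ p := by fun_prop

theorem WeightedIntegrable.aestronglyMeasurable_fun {n : ℕ} {s : ℝ} {u : E n → ℝ}
    (hu : WeightedIntegrable s u) : AEStronglyMeasurable u := by
  refine (hu.aestronglyMeasurable.mul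
    (measurable_weight (((n : ℝ) + 2 * s) / 2)).aestronglyMeasurable).congr
    (Eventually.of_forall fun y => ?_)
  have : 0 < (1 + ‖y‖ ^ 2) ^ (((n : ℝ) + 2 * s) / 2) := by positivity
  exact div_mul_cancel₀ _ this.ne'

/-- The bound on `k` is asked only where `u` is nonzero, so that `k` may be a kernel whose
singularity lies where `u` vanishes. -/
theorem WeightedIntegrable.integrable_mul {n : ℕ} {s : ℝ} {u k : E n → ℝ} {C : ℝ}
    (hu : WeightedIntegrable s u) (hk : AEStronglyMeasurable k)
    (hC : ∀ᵐ y, u y ≠ 0 → |k y| ≤ C * ((1 + ‖y‖ ^ 2) ^ (((n : ℝ) + 2 * s) / 2))⁻¹) :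
    Integrable fun y => u y * k y := by
  refine (hu.norm.const_mul C).mono' (hu.aestronglyMeasurable_fun.mul hk) ?_
  filter_upwards [hC] with y hy
  by_cases h0 : u y = 0
  · simp [h0]
  have : 0 < (1 + ‖y‖ ^ 2) ^ (((n : ℝ) + 2 * s) / 2) := by positivity
  rw [norm_mul, norm_div, Real.norm_of_nonneg this.le, Real.norm_eq_abs (k y)]
  calc ‖u y‖ * |k y| ≤ ‖u y‖ * (C * ((1 + ‖y‖ ^ 2) ^ (((n : ℝ) + 2 * s) / 2))⁻¹) := by
        gcongr; exact hy h0
    _ = _ := by rw [div_eq_mul_inv]; ring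

theorem WeightedIntegrable.add {n : ℕ} {s : ℝ} {u w : E n → ℝ} (hu : WeightedIntegrable s u)
    (hw : WeightedIntegrable s w) : WeightedIntegrable s fun y => u y + w y := by
  refine (Integrable.add hu hw).congr (Eventually.of_forall fun y => ?_)
  simp only [Pi.add_apply]; ring

theorem WeightedIntegrable.const_mul {n : ℕ} {s : ℝ} {u : E n → ℝ} (a : ℝ)
    (hu : WeightedIntegrable s u) : WeightedIntegrable s fun y => a * u y := by
  refine (Integrable.const_mul hu a).congr (Eventually.of_forall fun y => ?_)
  simp only; ring

theorem weightedIntegrable_const {n : ℕ} {s : ℝ} (hs : 0 < s) (a : ℝ) :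
    WeightedIntegrable s fun _ : E n => a := by
  have := integrable_rpow_neg_one_add_norm_sq (E := E n) (μ := volume) (r := (n : ℝ) + 2 * s)
    (by simp [hs])
  refine (this.const_mul a).congr (Eventually.of_forall fun y => ?_)
  simp only
  rw [neg_div, Real.rpow_neg (by positivity), ← div_eq_mul_inv]

theorem weightedIntegrable_of_compact {n : ℕ} {s : ℝ} {g : E n → ℝ} (hg : Continuous g)
    (hc : HasCompactSupport g) : WeightedIntegrable s g := by
  have h1 : Continuous fun y : E n => ((1 + ‖y‖ ^ 2) ^ (((n : ℝ) + 2 * s) / 2))⁻¹ := by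
    have h0 : ∀ y : E n, 0 < 1 + ‖y‖ ^ 2 := fun y => by positivity
    refine Continuous.inv₀ (Continuous.rpow_const (by fun_prop) fun y => Or.inl (h0 y).ne')
      fun y => (Real.rpow_pos_of_pos (h0 y) _).ne'
  exact (hg.mul h1).integrable_of_hasCompactSupport hc.mul_right

theorem WeightedIntegrable.integrableOn_kernel {n : ℕ} {s : ℝ} (hs : 0 < s) {u : E n → ℝ}
    (hu : WeightedIntegrable s u) (x : E n) {ε : ℝ} (hε : 0 < ε) :
    IntegrableOn (fun y => u y / ‖x - y‖ ^ ((n : ℝ) + 2 * s)) {y : E n | ε < ‖x - y‖} := by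
  obtain ⟨C, hC0, hC⟩ := inv_norm_sub_rpow_le (n := n) (p := (n : ℝ) + 2 * s) (R := ‖x‖)
    (by positivity) hε
  have hm : MeasurableSet {y : E n | ε < ‖x - y‖} := measurableSet_lt (by fun_prop) (by fun_prop)
  have hk : Measurable ({y : E n | ε < ‖x - y‖}.indicator
      fun y => (‖x - y‖ ^ ((n : ℝ) + 2 * s))⁻¹) := Measurable.indicator (by fun_prop) hm
  rw [← integrable_indicator_iff hm]
  refine (hu.integrable_mul (C := C) hk.aestronglyMeasurable
    (Eventually.of_forall fun y _ => ?_)).congr (Eventually.of_forall fun y => ?_)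
  · by_cases h : y ∈ {y : E n | ε < ‖x - y‖}
    · rw [indicator_of_mem h, abs_of_nonneg (by positivity)]
      exact hC x y le_rfl (le_of_lt h)
    · rw [indicator_of_notMem h, abs_zero]; positivity
  · by_cases h : y ∈ {y : E n | ε < ‖x - y‖}
    · simp only [indicator_of_mem h, div_eq_mul_inv]
    · simp only [indicator_of_notMem h, mul_zero]

theorem WeightedIntegrable.integrableOn_diff_kernel {n : ℕ} {s : ℝ} (hs : 0 < s) {u : E n → ℝ}
    (hu : WeightedIntegrable s u) (x : E n) {ε : ℝ} (hε : 0 < ε) :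
    IntegrableOn (fun y => (u x - u y) / ‖x - y‖ ^ ((n : ℝ) + 2 * s)) {y : E n | ε < ‖x - y‖} := by
  have h : WeightedIntegrable s fun y => u x + -1 * u y :=
    (weightedIntegrable_const hs (u x)).add (hu.const_mul (-1))
  refine (h.integrableOn_kernel hs x hε).congr (Eventually.of_forall fun y => ?_)
  simp only; ring

/-! ### Existence of the principal value. -/

theorem hasFracLapAt_of_contDiff {n : ℕ} (hn : n ≠ 0) {s : ℝ} (hs : 0 < s) (hs1 : s < 1)
    {g : E n → ℝ} (hg : ContDiff ℝ 2 g) (hc : HasCompactSupport g) (x : E n) :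
    HasFracLapAt s g x
      (normConst s n * (2⁻¹ * ∫ y, secondDiff g x y / ‖y‖ ^ ((n : ℝ) + 2 * s))) := by
  set p : ℝ := (n : ℝ) + 2 * s with hp
  have hw := weightedIntegrable_of_compact (s := s) hg.continuous hc
  refine Or.inr (Or.inr ⟨⟨hs, hs1⟩, fun ε hε => hw.integrableOn_diff_kernel hs x hε, ?_⟩)
  have hm : ∀ ε : ℝ, MeasurableSet {y : E n | ε < ‖y‖} := fun ε =>
    measurableSet_lt (by fun_prop) (by fun_prop)
  have htr : ∀ ε > 0, truncated s g x ε = normConst s n * (2⁻¹ *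
      ∫ y, {y : E n | ε < ‖y‖}.indicator (fun y => secondDiff g x y / ‖y‖ ^ p) y) := by
    intro ε hε
    have hm' : MeasurableSet {y : E n | ε < ‖x - y‖} :=
      measurableSet_lt (by fun_prop) (by fun_prop)
    set F : E n → ℝ := {y : E n | ε < ‖x - y‖}.indicator
      (fun y => (g x - g y) / ‖x - y‖ ^ p) with hF
    have hFi : Integrable F := by
      rw [hF, integrable_indicator_iff hm']; exact hw.integrableOn_diff_kernel hs x hε
    have h1 : ∫ y, F (x + y) = ∫ y, F y := integral_add_left_eq_self F x
    have h2 : ∫ y, F (x - y) = ∫ y, F y := integral_sub_left_eq_self F volume x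
    have h3 : ∫ y, F y = 2⁻¹ *
        ∫ y, {y : E n | ε < ‖y‖}.indicator (fun y => secondDiff g x y / ‖y‖ ^ p) y := by
      -- Averaging over `y ↦ x + y` and `y ↦ x - y` produces the second difference, whose integral
      -- converges absolutely.
      have h4 : ∫ y, F y = 2⁻¹ * ((∫ y, F (x + y)) + ∫ y, F (x - y)) := by
        rw [h1, h2]; ring
      rw [h4, ← integral_add (hFi.comp_add_left x) (hFi.comp_sub_left x)]
      congr 2
      ext y
      by_cases h : ε < ‖y‖
      · simp [hF, h, secondDiff]; ring
      · simp [hF, h]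
    rw [truncated, ← integral_indicator hm', ← h3]
  refine Tendsto.congr' (f₁ := fun ε => normConst s n * (2⁻¹ *
      ∫ y, {y : E n | ε < ‖y‖}.indicator (fun y => secondDiff g x y / ‖y‖ ^ p) y)) ?_ ?_
  · filter_upwards [self_mem_nhdsWithin] with ε hε
    exact (htr ε hε).symm
  refine Tendsto.const_mul _ (Tendsto.const_mul _ ?_)
  have hi := integrable_secondDiff hn hs hs1 hg hc x
  refine tendsto_integral_filter_of_dominated_convergence
    (fun y => ‖secondDiff g x y / ‖y‖ ^ p‖) ?_ ?_ hi.norm ?_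
  · exact Eventually.of_forall fun ε => hi.aestronglyMeasurable.indicator (hm ε)
  · exact Eventually.of_forall fun ε => Eventually.of_forall fun y => norm_indicator_le_norm_self _ _
  · refine Eventually.of_forall fun y => ?_
    by_cases hy : y = 0
    · subst hy
      have : secondDiff g x 0 = 0 := by simp [secondDiff]; ring
      simp [indicator, this]
    · refine tendsto_const_nhds.congr' ?_
      have : Iio ‖y‖ ∈ 𝓝[>] (0 : ℝ) := mem_nhdsWithin_of_mem_nhds (Iio_mem_nhds (norm_pos_iff.mpr hy))
      filter_upwards [this] with ε hε
      rw [indicator_of_mem]; exact hε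

/-- The integrand is zero near `x`, so the truncated integrals are constant for small `ε`. -/
theorem hasFracLapAt_of_vanishing {n : ℕ} {s : ℝ} (hs : 0 < s) (hs1 : s < 1)
    {w : E n → ℝ} (hw : WeightedIntegrable s w) {x : E n} (h0 : w =ᶠ[𝓝 x] 0) :
    HasFracLapAt s w x (-normConst s n * ∫ y, w y / ‖x - y‖ ^ ((n : ℝ) + 2 * s)) := by
  refine Or.inr (Or.inr ⟨⟨hs, hs1⟩, fun ε hε => hw.integrableOn_diff_kernel hs x hε, ?_⟩)
  obtain ⟨δ, hδ, hball⟩ := Metric.eventually_nhds_iff.mp h0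
  have hx : w x = 0 := h0.self_of_nhds
  refine tendsto_const_nhds.congr' ?_
  filter_upwards [mem_nhdsWithin_of_mem_nhds (Iio_mem_nhds hδ)] with ε hε
  have hm' : MeasurableSet {y : E n | ε < ‖x - y‖} :=
    measurableSet_lt (by fun_prop) (by fun_prop)
  rw [truncated, ← integral_indicator hm', neg_mul, ← mul_neg, ← integral_neg]
  congr 2
  ext y
  by_cases h : ε < ‖x - y‖
  · simp [h, hx, neg_div]
  · have : w y = 0 := hball (by
      rw [dist_comm, dist_eq_norm]; exact (not_lt.mp h).trans_lt hε)
    simp [h, this]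

/-! ### Commutation with `x·∇` for compactly supported functions. -/

/-- The radial derivative `x · ∇g(x)`. -/
noncomputable def euler {n : ℕ} (g : E n → ℝ) (x : E n) : ℝ := fderiv ℝ g x x

theorem contDiff_euler {n : ℕ} {g : E n → ℝ} {k m : ℕ∞ω} (hg : ContDiff ℝ k g)
    (hkm : m + 1 ≤ k) : ContDiff ℝ m (euler g) :=
  (hg.fderiv_right hkm).clm_apply contDiff_id

theorem hasCompactSupport_euler {n : ℕ} {g : E n → ℝ} (hc : HasCompactSupport g) :
    HasCompactSupport (euler g) := by
  refine (hc.fderiv ℝ).mono' ?_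
  refine fun x hx => subset_tsupport _ ?_
  intro h
  exact hx (by simp [euler, h])

theorem hasDerivAt_smul_const {n : ℕ} (x : E n) (t : ℝ) :
    HasDerivAt (fun t : ℝ => t • x) x t := by
  simpa using (hasDerivAt_id t).smul_const x

theorem hasDerivAt_comp_smul {n : ℕ} {g : E n → ℝ} {x : E n} {t : ℝ}
    (hg : DifferentiableAt ℝ g (t • x)) (ht : t ≠ 0) :
    HasDerivAt (fun t : ℝ => g (t • x)) (euler g (t • x) / t) t := by
  have := hg.hasFDerivAt.comp_hasDerivAt t (hasDerivAt_smul_const x t)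
  refine this.congr_deriv ?_
  rw [euler, map_smul, smul_eq_mul, mul_div_cancel_left₀ _ ht]

theorem laplacian_eq_sum_fderiv {n : ℕ} (g : E n → ℝ) (x : E n) :
    Laplacian.laplacian g x = ∑ i, fderiv ℝ (fderiv ℝ g) x (EuclideanSpace.basisFun (Fin n) ℝ i)
      (EuclideanSpace.basisFun (Fin n) ℝ i) := by
  rw [InnerProductSpace.laplacian_eq_iteratedFDeriv_orthonormalBasis g
    (EuclideanSpace.basisFun (Fin n) ℝ)]
  simp [iteratedFDeriv_two_apply]

theorem fderiv_fderiv_euler {n : ℕ} {g : E n → ℝ} {x : E n} (hg : ContDiffAt ℝ 3 g x) (e : E n) :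
    fderiv ℝ (fderiv ℝ (euler g)) x e e =
      fderiv ℝ (fderiv ℝ (fderiv ℝ g)) x x e e + 2 * fderiv ℝ (fderiv ℝ g) x e e := by
  have hg1 : ContDiffAt ℝ 2 (fderiv ℝ g) x := hg.fderiv_right (by norm_num)
  have hg2 : ContDiffAt ℝ 1 (fderiv ℝ (fderiv ℝ g)) x := hg1.fderiv_right (by norm_num)
  have hd2 : DifferentiableAt ℝ (fderiv ℝ (fderiv ℝ g)) x := hg2.differentiableAt (by norm_num)
  have hev : ∀ᶠ z in 𝓝 x, ContDiffAt ℝ 3 g z := hg.eventually (by simp)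
  have h1 : fderiv ℝ (euler g) =ᶠ[𝓝 x]
      fun z => (fderiv ℝ (fderiv ℝ g) z).flip z + fderiv ℝ g z := by
    filter_upwards [hev] with z hz
    have hz1 : DifferentiableAt ℝ (fderiv ℝ g) z :=
      (hz.fderiv_right (m := 2) (by norm_num)).differentiableAt (by norm_num)
    have := hz1.hasFDerivAt.clm_apply (hasFDerivAt_id z)
    refine (HasFDerivAt.fderiv this).trans ?_
    ext v
    simp [add_comm]
  rw [h1.fderiv_eq]
  have h2 : HasFDerivAt (fun z => (fderiv ℝ (fderiv ℝ g) z) e e)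
      (((fderiv ℝ (fderiv ℝ (fderiv ℝ g)) x).flip e).flip e) x := by
    have := (hd2.hasFDerivAt.clm_apply (hasFDerivAt_const e x)).clm_apply (hasFDerivAt_const e x)
    refine this.congr_fderiv ?_
    ext v; simp
  -- Only the existence of this derivative matters; its value on `e` is then read off from `hB` by
  -- uniqueness.
  have hA : HasFDerivAt (fun z => (fderiv ℝ (fderiv ℝ g) z).flip z + fderiv ℝ g z)
      (fderiv ℝ (fun z => (fderiv ℝ (fderiv ℝ g) z).flip z + fderiv ℝ g z) x) x := by
    have he : ContDiffAt ℝ 2 (euler g) x := hg1.clm_apply contDiffAt_id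
    exact (h1.differentiableAt_iff.mp ((he.fderiv_right (m := 1) (by norm_num)).differentiableAt
      (by norm_num))).hasFDerivAt
  have hA' := hA.clm_apply (hasFDerivAt_const e x)
  have hB : HasFDerivAt (fun z => ((fderiv ℝ (fderiv ℝ g) z).flip z + fderiv ℝ g z) e)
      (((fderiv ℝ (fderiv ℝ (fderiv ℝ g)) x).flip e).flip x + fderiv ℝ (fderiv ℝ g) x e
        + (fderiv ℝ (fderiv ℝ g) x).flip e) x := by
    have h3 := (hd2.hasFDerivAt.clm_apply (hasFDerivAt_const e x)).clm_apply (hasFDerivAt_id x)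
    have h4 := (hg1.differentiableAt (by norm_num)).hasFDerivAt.clm_apply (hasFDerivAt_const e x)
    refine (h3.add h4).congr_fderiv ?_
    ext v; simp [add_comm]
  have h5 := congrArg (fun l => l e) (hA'.unique hB)
  simp at h5
  rw [h5]
  -- Symmetry of `D³g` moves `x` to the first slot: `hs3` swaps the last two arguments by
  -- differentiating the symmetry of `D²g`, and `hs2` swaps the first two.
  have hs1 : IsSymmSndFDerivAt ℝ (fderiv ℝ g) x :=
    hg1.isSymmSndFDerivAt (by simp)
  have hs2 : fderiv ℝ (fderiv ℝ (fderiv ℝ g)) x e x = fderiv ℝ (fderiv ℝ (fderiv ℝ g)) x x e :=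
    hs1 e x
  have hs3 : fderiv ℝ (fderiv ℝ (fderiv ℝ g)) x e e x =
      fderiv ℝ (fderiv ℝ (fderiv ℝ g)) x e x e := by
    have h6 : (fun z => fderiv ℝ (fderiv ℝ g) z e x) =ᶠ[𝓝 x]
        fun z => fderiv ℝ (fderiv ℝ g) z x e := by
      filter_upwards [hev] with z hz
      exact hz.isSymmSndFDerivAt (by simp; norm_num) e x
    have h7 := (hd2.hasFDerivAt.clm_apply (hasFDerivAt_const e x)).clm_apply (hasFDerivAt_const x x)
    have h8 := (hd2.hasFDerivAt.clm_apply (hasFDerivAt_const x x)).clm_apply (hasFDerivAt_const e x)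
    have h9 := congrArg (fun l => l e) ((h7.congr_of_eventuallyEq h6.symm).unique h8)
    simpa using h9
  rw [hs3, hs2]
  ring

/-- The commutator of the Laplacian and the radial derivative. -/
theorem hasDerivAt_laplacian_ray {n : ℕ} {g : E n → ℝ} {x : E n} (hg : ContDiffAt ℝ 3 g x) :
    HasDerivAt (fun t : ℝ => Laplacian.laplacian g (t • x))
      (Laplacian.laplacian (euler g) x - 2 * Laplacian.laplacian g x) 1 := by
  have hg2 : ContDiffAt ℝ 1 (fderiv ℝ (fderiv ℝ g)) x :=
    (hg.fderiv_right (m := 2) (by norm_num)).fderiv_right (by norm_num)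
  have hd2 : DifferentiableAt ℝ (fderiv ℝ (fderiv ℝ g)) ((1 : ℝ) • x) := by
    rw [one_smul]; exact hg2.differentiableAt (by norm_num)
  have h1 : HasDerivAt (fun t : ℝ => fderiv ℝ (fderiv ℝ g) (t • x))
      (fderiv ℝ (fderiv ℝ (fderiv ℝ g)) x x) 1 := by
    have := HasFDerivAt.comp_hasDerivAt (l := fderiv ℝ (fderiv ℝ g)) 1 hd2.hasFDerivAt
      (hasDerivAt_smul_const x 1)
    simp only [one_smul] at this
    exact this
  simp only [laplacian_eq_sum_fderiv, Finset.mul_sum, ← Finset.sum_sub_distrib]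
  refine HasDerivAt.fun_sum fun i _ => ?_
  rw [fderiv_fderiv_euler hg, add_sub_cancel_right]
  have := (h1.clm_apply (hasDerivAt_const 1 (EuclideanSpace.basisFun (Fin n) ℝ i))).clm_apply
    (hasDerivAt_const 1 (EuclideanSpace.basisFun (Fin n) ℝ i))
  simpa using this

theorem hasFracLapAt_fracLap {n : ℕ} (hn : n ≠ 0) {s : ℝ} (hs : s ∈ Icc (0 : ℝ) 1)
    {g : E n → ℝ} (hg : ContDiff ℝ 2 g) (hc : HasCompactSupport g) (x : E n) :
    HasFracLapAt s g x (fracLap s g x) := by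
  suffices h : ∃ L, HasFracLapAt s g x L by
    obtain ⟨L, hL⟩ := h
    rwa [hL.fracLap_eq]
  rcases hs.1.eq_or_lt with rfl | h0
  · exact ⟨g x, Or.inl ⟨rfl, rfl⟩⟩
  rcases hs.2.eq_or_lt with rfl | h1
  · exact ⟨_, Or.inr (Or.inl ⟨rfl, hg.contDiffAt, rfl⟩)⟩
  exact ⟨_, hasFracLapAt_of_contDiff hn h0 h1 hg hc x⟩

theorem fracLap_zero {n : ℕ} (g : E n → ℝ) : fracLap 0 g = g :=
  funext fun _ => HasFracLapAt.fracLap_eq (Or.inl ⟨rfl, rfl⟩)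

theorem fracLap_one {n : ℕ} {g : E n → ℝ} (hg : ContDiff ℝ 2 g) :
    fracLap 1 g = fun x => -Laplacian.laplacian g x :=
  funext fun _ => HasFracLapAt.fracLap_eq (Or.inr (Or.inl ⟨rfl, hg.contDiffAt, rfl⟩))

/-- The substitution `y = t z` puts all dependence on `t` into `g` and a power, so that
differentiation in `t` never touches the singular kernel. -/
theorem integral_secondDiff_smul {n : ℕ} {s t : ℝ} (ht : 0 < t) (g : E n → ℝ) (x : E n) :
    ∫ y, secondDiff g (t • x) y / ‖y‖ ^ ((n : ℝ) + 2 * s) =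
      t ^ (-(2 * s)) * ∫ z, secondDiff g (t • x) (t • z) / ‖z‖ ^ ((n : ℝ) + 2 * s) := by
  have h := Measure.integral_comp_smul (volume : Measure (E n))
    (fun y => secondDiff g (t • x) y / ‖y‖ ^ ((n : ℝ) + 2 * s)) t
  have h2 : ∫ z, secondDiff g (t • x) (t • z) / ‖z‖ ^ ((n : ℝ) + 2 * s) =
      t ^ ((n : ℝ) + 2 * s) *
        ∫ z, secondDiff g (t • x) (t • z) / ‖t • z‖ ^ ((n : ℝ) + 2 * s) := by
    rw [← integral_const_mul]
    congr 1
    ext z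
    have : 0 < t ^ ((n : ℝ) + 2 * s) := by positivity
    rw [norm_smul, Real.norm_of_nonneg ht.le, Real.mul_rpow ht.le (norm_nonneg z)]
    field_simp
  rw [h2, h, finrank_euclideanSpace_fin, abs_of_pos (by positivity), smul_eq_mul, ← mul_assoc,
    ← mul_assoc, ← Real.rpow_natCast t n, ← Real.rpow_neg ht.le, ← Real.rpow_add ht,
    ← Real.rpow_add ht]
  have : -(2 * s) + ((n : ℝ) + 2 * s) + -(n : ℝ) = 0 := by ring
  rw [this, Real.rpow_zero, one_mul]

theorem hasDerivAt_secondDiff {n : ℕ} {g : E n → ℝ} (hg : Differentiable ℝ g) (x z : E n) {t : ℝ}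
    (ht : t ≠ 0) : HasDerivAt (fun t : ℝ => secondDiff g (t • x) (t • z))
      (secondDiff (euler g) (t • x) (t • z) / t) t := by
  have h1 := hasDerivAt_comp_smul (hg (t • x)) ht
  have h2 := hasDerivAt_comp_smul (hg (t • (x + z))) ht
  have h3 := hasDerivAt_comp_smul (hg (t • (x - z))) ht
  simp only [secondDiff, ← smul_add, ← smul_sub]
  refine (((h1.const_mul 2).sub h2).sub h3).congr_deriv ?_
  ring

theorem hasDerivAt_integral_secondDiff {n : ℕ} (hn : n ≠ 0) {s : ℝ} (hs : 0 < s) (hs1 : s < 1)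
    {g : E n → ℝ} (hg : ContDiff ℝ 3 g) (hc : HasCompactSupport g) (x : E n) :
    HasDerivAt (fun t : ℝ => ∫ z, secondDiff g (t • x) (t • z) / ‖z‖ ^ ((n : ℝ) + 2 * s))
      (∫ z, secondDiff (euler g) x z / ‖z‖ ^ ((n : ℝ) + 2 * s)) 1 := by
  have he : ContDiff ℝ 2 (euler g) := contDiff_euler hg (by norm_num)
  obtain ⟨C, hC0, hC⟩ := secondDiff_bound he (hasCompactSupport_euler hc)
  have hmeas : ∀ {k : E n → ℝ}, Continuous k → ∀ t : ℝ, AEStronglyMeasurable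
      (fun z : E n => secondDiff k (t • x) (t • z) / ‖z‖ ^ ((n : ℝ) + 2 * s)) := by
    intro k hk t
    refine (Measurable.div ?_ (by fun_prop)).aestronglyMeasurable
    exact ((continuous_secondDiff hk).comp (by fun_prop :
      Continuous fun z : E n => (t • x, t • z))).measurable
  have hnhds : Ioo (1 / 2 : ℝ) 2 ∈ 𝓝 (1 : ℝ) := Ioo_mem_nhds (by norm_num) (by norm_num)
  have key := (hasDerivAt_integral_of_dominated_loc_of_deriv_le
    (μ := (volume : Measure (E n))) (x₀ := (1 : ℝ))
    (F := fun t z => secondDiff g (t • x) (t • z) / ‖z‖ ^ ((n : ℝ) + 2 * s))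
    (F' := fun t z => secondDiff (euler g) (t • x) (t • z) / t / ‖z‖ ^ ((n : ℝ) + 2 * s))
    -- For `1/2 < t < 2`, dilating `z` costs a factor `4` and dividing by `t` a factor `2`.
    (bound := fun z => 8 * C * (min 1 (‖z‖ ^ 2) / ‖z‖ ^ ((n : ℝ) + 2 * s)))
    hnhds (Eventually.of_forall fun t => hmeas hg.continuous t) ?_ ?_ ?_
    ((integrable_min_kernel hn hs hs1).const_mul _) ?_).2
  · simpa using key
  · simpa using integrable_secondDiff hn hs hs1 (hg.of_le (by norm_num)) hc x
  · simpa using hmeas he.continuous 1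
  · refine Eventually.of_forall fun z t ht => ?_
    have ht0 : 0 < t := lt_trans (by norm_num) ht.1
    have hmin : min 1 (‖t • z‖ ^ 2) ≤ 4 * min 1 (‖z‖ ^ 2) := by
      rw [norm_smul, Real.norm_of_nonneg ht0.le, mul_pow, mul_min_of_nonneg _ _ (by norm_num)]
      refine min_le_min (by norm_num) ?_
      gcongr
      nlinarith [ht.2]
    have hb : |secondDiff (euler g) (t • x) (t • z) / t| ≤ 8 * C * min 1 (‖z‖ ^ 2) := by
      rw [abs_div, abs_of_pos ht0, div_le_iff₀ ht0]
      refine (hC _ _).trans ?_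
      have h1 := mul_le_mul_of_nonneg_left hmin hC0
      have h2 : 0 ≤ C * min 1 (‖z‖ ^ 2) := by positivity
      nlinarith [ht.1]
    have hk : 0 ≤ ‖z‖ ^ ((n : ℝ) + 2 * s) := by positivity
    rw [norm_div, Real.norm_eq_abs, Real.norm_of_nonneg hk, ← mul_div_assoc]
    gcongr
  · refine Eventually.of_forall fun z t ht => ?_
    have ht0 : 0 < t := lt_trans (by norm_num) ht.1
    exact (hasDerivAt_secondDiff (hg.differentiable (by norm_num)) x z ht0.ne').div_const _

/-- Commutation of `(-Δ)^s` with the radial derivative, on test functions. -/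
theorem hasDerivAt_fracLap_ray {n : ℕ} (hn : n ≠ 0) {s : ℝ} (hs : s ∈ Icc (0 : ℝ) 1)
    {g : E n → ℝ} (hg : ContDiff ℝ 3 g) (hc : HasCompactSupport g) (x : E n) :
    HasDerivAt (fun t : ℝ => fracLap s g (t • x))
      (fracLap s (euler g) x - 2 * s * fracLap s g x) 1 := by
  have hg2 : ContDiff ℝ 2 g := hg.of_le (by norm_num)
  have he : ContDiff ℝ 2 (euler g) := contDiff_euler hg (by norm_num)
  have hec := hasCompactSupport_euler hc
  rcases hs.1.eq_or_lt with rfl | h0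
  · simp only [fracLap_zero, mul_zero, zero_mul, sub_zero]
    have := hasDerivAt_comp_smul (x := x) (t := 1) (hg.differentiable (by norm_num) _) one_ne_zero
    simpa using this
  rcases hs.2.eq_or_lt with rfl | h1
  · rw [fracLap_one hg2, fracLap_one he]
    refine (hasDerivAt_laplacian_ray hg.contDiffAt).neg.congr_deriv ?_
    ring
  have hval : ∀ {k : E n → ℝ}, ContDiff ℝ 2 k → HasCompactSupport k → ∀ x, fracLap s k x =
      normConst s n * (2⁻¹ * ∫ y, secondDiff k x y / ‖y‖ ^ ((n : ℝ) + 2 * s)) :=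
    fun hk hkc x => (hasFracLapAt_of_contDiff hn h0 h1 hk hkc x).fracLap_eq
  have hpow : HasDerivAt (fun t : ℝ => t ^ (-(2 * s))) (-(2 * s)) 1 := by
    simpa using Real.hasDerivAt_rpow_const (x := 1) (p := -(2 * s)) (Or.inl one_ne_zero)
  have hJ := hasDerivAt_integral_secondDiff hn h0 h1 hg hc x
  have hprod := ((hpow.mul hJ).const_mul (2⁻¹)).const_mul (normConst s n)
  simp only [one_smul, Real.one_rpow, one_mul] at hprod
  refine (hprod.congr_deriv ?_).congr_of_eventuallyEq ?_
  · rw [hval he hec, hval hg2 hc]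
    ring
  · filter_upwards [Ioi_mem_nhds one_pos] with t ht
    rw [hval hg2 hc, integral_secondDiff_smul ht]
    rfl

/-! ### Decay of `(-Δ)^s g` and absolute convergence of the pairing. -/

theorem exists_bound_weight_of_compact {n : ℕ} {k : E n → ℝ} (hk : Continuous k)
    (hc : HasCompactSupport k) (p : ℝ) :
    ∃ C, ∀ x, |k x| ≤ C * ((1 + ‖x‖ ^ 2) ^ p)⁻¹ := by
  have h0 : ∀ y : E n, 0 < 1 + ‖y‖ ^ 2 := fun y => by positivity
  have h1 : Continuous fun y : E n => (1 + ‖y‖ ^ 2) ^ p :=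
    Continuous.rpow_const (by fun_prop) fun y => Or.inl (h0 y).ne'
  obtain ⟨C, hC⟩ := (hc.mul_right (f' := fun y : E n => (1 + ‖y‖ ^ 2) ^ p)).exists_bound_of_continuous
    (hk.mul h1)
  refine ⟨C, fun x => ?_⟩
  have hp : 0 < (1 + ‖x‖ ^ 2) ^ p := Real.rpow_pos_of_pos (h0 x) _
  rw [← div_eq_mul_inv, le_div_iff₀ hp]
  have := hC x
  rwa [Pi.mul_apply, norm_mul, Real.norm_of_nonneg hp.le] at this

theorem continuous_laplacian {n : ℕ} {g : E n → ℝ} (hg : ContDiff ℝ 2 g) :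
    Continuous (Laplacian.laplacian g) := by
  have h1 : Continuous (fderiv ℝ (fderiv ℝ g)) :=
    (hg.fderiv_right (m := 1) (by norm_num)).continuous_fderiv (by norm_num)
  have : Laplacian.laplacian g = fun x => ∑ i, fderiv ℝ (fderiv ℝ g) x
      (EuclideanSpace.basisFun (Fin n) ℝ i) (EuclideanSpace.basisFun (Fin n) ℝ i) :=
    funext (laplacian_eq_sum_fderiv g)
  rw [this]
  fun_prop

theorem hasCompactSupport_laplacian {n : ℕ} {g : E n → ℝ} (hc : HasCompactSupport g) :
    HasCompactSupport (Laplacian.laplacian g) := by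
  refine ((hc.fderiv ℝ).fderiv ℝ).mono' fun x hx => subset_tsupport _ fun h => hx ?_
  rw [laplacian_eq_sum_fderiv, h]
  simp

theorem fracLap_decay {n : ℕ} (hn : n ≠ 0) {s : ℝ} (hs : s ∈ Icc (0 : ℝ) 1)
    {g : E n → ℝ} (hg : ContDiff ℝ 2 g) (hc : HasCompactSupport g) :
    ∃ C, ∀ x, |fracLap s g x| ≤ C * ((1 + ‖x‖ ^ 2) ^ (((n : ℝ) + 2 * s) / 2))⁻¹ := by
  rcases hs.1.eq_or_lt with rfl | h0
  · rw [fracLap_zero]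
    exact exists_bound_weight_of_compact hg.continuous hc _
  rcases hs.2.eq_or_lt with rfl | h1
  · rw [fracLap_one hg]
    simp only [abs_neg]
    exact exists_bound_weight_of_compact (continuous_laplacian hg) (hasCompactSupport_laplacian hc) _
  set p : ℝ := (n : ℝ) + 2 * s with hp
  have hp0 : 0 ≤ p := by positivity
  obtain ⟨R, hR0, hR⟩ := hc.isCompact.isBounded.subset_closedBall_lt 0 0
  obtain ⟨C, hC0, hC⟩ := secondDiff_bound hg hc
  obtain ⟨D, hD0, hD⟩ := inv_norm_sub_rpow_le (n := n) (R := R) hp0 one_pos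
  set B := |normConst s n| * (2⁻¹ * ∫ y : E n, C * (min 1 (‖y‖ ^ 2) / ‖y‖ ^ p)) with hB
  -- The second-difference bound is uniform in `x`, so it suffices on a ball; outside it `g`
  -- vanishes near `x` and the kernel itself decays.
  have hnear : ∀ x, |fracLap s g x| ≤ B := by
    intro x
    rw [(hasFracLapAt_of_contDiff hn h0 h1 hg hc x).fracLap_eq, abs_mul, abs_mul,
      abs_of_pos (show (0 : ℝ) < 2⁻¹ by norm_num), hB]
    refine mul_le_mul_of_nonneg_left (mul_le_mul_of_nonneg_left ?_ (by norm_num)) (abs_nonneg _)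
    exact norm_integral_le_of_norm_le ((integrable_min_kernel hn h0 h1).const_mul C)
      (Eventually.of_forall fun y => norm_secondDiff_kernel_le (hC x y))
  have hB0 : 0 ≤ B := (abs_nonneg _).trans (hnear 0)
  have hgi : Integrable g := hg.continuous.integrable_of_hasCompactSupport hc
  have hfar : ∀ x, R + 1 ≤ ‖x‖ → |fracLap s g x| ≤
      (|normConst s n| * (D * ∫ y, ‖g y‖)) * ((1 + ‖x‖ ^ 2) ^ (p / 2))⁻¹ := by
    intro x hx
    have hz : g =ᶠ[𝓝 x] 0 := by
      rw [← notMem_tsupport_iff_eventuallyEq]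
      intro h
      have := hR h
      rw [mem_closedBall_zero_iff] at this
      linarith
    rw [(hasFracLapAt_of_vanishing h0 h1 (weightedIntegrable_of_compact hg.continuous hc)
      hz).fracLap_eq, abs_mul, abs_neg, mul_assoc]
    gcongr
    rw [mul_comm D, mul_assoc, ← integral_mul_const]
    refine (Real.norm_eq_abs _).symm.trans_le <|
      norm_integral_le_of_norm_le (hgi.norm.mul_const _) (Eventually.of_forall fun y => ?_)
    by_cases hy : g y = 0
    · simp [hy]
    have hyR : ‖y‖ ≤ R := by
      simpa using hR (subset_tsupport _ hy)
    have hd : 1 ≤ ‖y - x‖ := by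
      have := norm_sub_norm_le x y
      rw [norm_sub_rev] at this
      linarith
    rw [norm_div, Real.norm_of_nonneg (by positivity : 0 ≤ ‖x - y‖ ^ p), div_eq_mul_inv,
      norm_sub_rev]
    gcongr
    exact hD y x hyR hd
  refine ⟨max (B * (1 + (R + 1) ^ 2) ^ (p / 2)) (|normConst s n| * (D * ∫ y, ‖g y‖)), fun x => ?_⟩
  rcases le_total (R + 1) ‖x‖ with h | h
  · refine (hfar x h).trans ?_
    gcongr
    exact le_max_right _ _
  · refine (hnear x).trans ?_
    have h2 : (1 + ‖x‖ ^ 2) ^ (p / 2) ≤ (1 + (R + 1) ^ 2) ^ (p / 2) := by gcongr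
    have h3 : 0 < (1 + ‖x‖ ^ 2) ^ (p / 2) := by positivity
    rw [← div_eq_mul_inv, le_div_iff₀ h3]
    exact (mul_le_mul_of_nonneg_left h2 hB0).trans (le_max_left _ _)

theorem aestronglyMeasurable_fracLap {n : ℕ} (hn : n ≠ 0) {s : ℝ} (hs : s ∈ Icc (0 : ℝ) 1)
    {g : E n → ℝ} (hg : ContDiff ℝ 2 g) (hc : HasCompactSupport g) :
    AEStronglyMeasurable (fracLap s g) := by
  rcases hs.1.eq_or_lt with rfl | h0
  · rw [fracLap_zero]
    exact hg.continuous.aestronglyMeasurable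
  rcases hs.2.eq_or_lt with rfl | h1
  · rw [fracLap_one hg]
    exact (continuous_laplacian hg).neg.aestronglyMeasurable
  have : fracLap s g = fun x => normConst s n *
      (2⁻¹ * ∫ y, secondDiff g x y / ‖y‖ ^ ((n : ℝ) + 2 * s)) :=
    funext fun x => (hasFracLapAt_of_contDiff hn h0 h1 hg hc x).fracLap_eq
  rw [this]
  have hm := ((measurable_secondDiff_kernel hg.continuous
    ((n : ℝ) + 2 * s)).stronglyMeasurable.integral_prod_right' (ν := volume)).aestronglyMeasurable
    (μ := volume)
  exact (hm.const_mul _).const_mul _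

theorem WeightedIntegrable.integrable_mul_fracLap {n : ℕ} (hn : n ≠ 0) {s : ℝ}
    (hs : s ∈ Icc (0 : ℝ) 1) {u g : E n → ℝ} (hu : WeightedIntegrable s u)
    (hg : ContDiff ℝ 2 g) (hc : HasCompactSupport g) :
    Integrable fun x => u x * fracLap s g x := by
  obtain ⟨C, hC⟩ := fracLap_decay hn hs hg hc
  exact hu.integrable_mul (aestronglyMeasurable_fracLap hn hs hg hc)
    (Eventually.of_forall fun x _ => hC x)

/-! ### The formula for distributions. -/

theorem div_smul_self {n : ℕ} {g : E n → ℝ} (hg : Differentiable ℝ g) :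
    div (fun x => g x • x) = fun x => n * g x + euler g x := by
  ext x
  have h : HasFDerivAt (fun x => g x • x)
      (g x • ContinuousLinearMap.id ℝ (E n) + (fderiv ℝ g x).smulRight x) x :=
    (hg x).hasFDerivAt.smul (hasFDerivAt_id x)
  have hx : x = ∑ i, x i • EuclideanSpace.single i (1 : ℝ) := by
    have := (EuclideanSpace.basisFun (Fin n) ℝ).sum_repr x
    simpa using this.symm
  have he : euler g x = ∑ i, fderiv ℝ g x (EuclideanSpace.single i 1) * x i := by
    rw [euler]
    nth_rewrite 2 [hx]
    simp [mul_comm]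
  rw [div, h.fderiv, he]
  simp [Finset.sum_add_distrib]

theorem contDiff_div_norm {n : ℕ} {h : E n → ℝ} (hh : ContDiff ℝ ∞ h)
    (h0 : tsupport h ⊆ {0}ᶜ) : ContDiff ℝ ∞ fun x => h x / ‖x‖ := by
  rw [contDiff_iff_contDiffAt]
  intro x
  by_cases hx : x = 0
  · subst hx
    have : h =ᶠ[𝓝 0] 0 := notMem_tsupport_iff_eventuallyEq.mp fun hm => h0 hm rfl
    refine (contDiffAt_const (c := (0 : ℝ))).congr_of_eventuallyEq ?_
    filter_upwards [this] with y hy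
    simp [hy]
  · exact hh.contDiffAt.div (contDiffAt_norm ℝ hx) (norm_ne_zero_iff.mpr hx)

theorem fracLap_linear {n : ℕ} (hn : n ≠ 0) {s : ℝ} (hs : s ∈ Icc (0 : ℝ) 1)
    {g k : E n → ℝ} (hg : ContDiff ℝ 2 g) (hgc : HasCompactSupport g) (hk : ContDiff ℝ 2 k)
    (hkc : HasCompactSupport k) (a : ℝ) (x : E n) :
    fracLap s (fun y => a * g y + k y) x = a * fracLap s g x + fracLap s k x :=
  (((hasFracLapAt_fracLap hn hs hg hgc x).const_mul a).add
    (hasFracLapAt_fracLap hn hs hk hkc x)).fracLap_eq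

/-- The formula in the sense of distributions. -/
theorem distRadialDeriv_distFracLap {n : ℕ} (hn : n ≠ 0) {s : ℝ} (hs : s ∈ Icc (0 : ℝ) 1)
    {u v : E n → ℝ} (hu : WeightedIntegrable s u) (hv : WeightedIntegrable s v)
    (huv : ∀ x ≠ 0, HasDerivAt (fun t : ℝ => u (t • x)) (v x + 2 * s * u x) 1)
    {h : E n → ℝ} (hh : IsTest {0}ᶜ h) :
    distRadialDeriv (distFracLap s u) h = distDivRadius (distFracLap s v) h := by
  obtain ⟨hsm, hc, h0⟩ := hh
  set g : E n → ℝ := fun x => h x / ‖x‖ with hgdef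
  have hg : ContDiff ℝ ∞ g := contDiff_div_norm hsm h0
  have hgc : HasCompactSupport g := by
    simp only [hgdef, div_eq_mul_inv]
    exact hc.mul_right
  have hg3 : ContDiff ℝ 3 g := by exact_mod_cast contDiff_infty.mp hg 3
  have hg2 : ContDiff ℝ 2 g := hg3.of_le (by norm_num)
  have he : ContDiff ℝ 2 (euler g) := contDiff_euler hg3 (by norm_num)
  have hec := hasCompactSupport_euler hgc
  have iu := hu.integrable_mul_fracLap hn hs hg2 hgc
  have iv := hv.integrable_mul_fracLap hn hs hg2 hgc
  have ie := hu.integrable_mul_fracLap hn hs he hec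
  have key := integral_euler hn (f := fun x => u x * fracLap s g x)
    (f' := fun x => v x * fracLap s g x + u x * fracLap s (euler g) x) iu (iv.add ie) ?_
  · rw [integral_add iv ie] at key
    simp only [distRadialDeriv, distDivRadius, distFracLap]
    have hdiv : div (fun x => (h x / ‖x‖) • x) = fun x => n * g x + euler g x :=
      div_smul_self (hg2.differentiable (by norm_num))
    rw [hdiv]
    have : ∀ x, u x * fracLap s (fun x => n * g x + euler g x) x =
        n * (u x * fracLap s g x) + u x * fracLap s (euler g) x := by
      intro x
      rw [fracLap_linear hn hs hg2 hgc he hec]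
      ring
    simp only [this]
    rw [integral_add (iu.const_mul _) ie, integral_const_mul]
    linarith
  · intro x hx
    refine ((huv x hx).mul (hasDerivAt_fracLap_ray hn hs hg3 hgc x)).congr_deriv ?_
    simp only [one_smul]
    ring

/-! ### Rotation invariance. -/

/-- The trace of the Hessian can be taken in any orthonormal basis: the standard one for `u ∘ T`,
its image under `T` for `u`. -/
theorem laplacian_comp_linearIsometryEquiv {n : ℕ} {u : E n → ℝ} (T : E n ≃ₗᵢ[ℝ] E n) (x : E n) :
    Laplacian.laplacian (u ∘ T) x = Laplacian.laplacian u (T x) := by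
  rw [InnerProductSpace.laplacian_eq_iteratedFDeriv_orthonormalBasis (u ∘ T)
    (EuclideanSpace.basisFun (Fin n) ℝ),
    InnerProductSpace.laplacian_eq_iteratedFDeriv_orthonormalBasis u
    ((EuclideanSpace.basisFun (Fin n) ℝ).map T)]
  have := ContinuousLinearEquiv.iteratedFDerivWithin_comp_right T.toContinuousLinearEquiv u
    uniqueDiffOn_univ (x := x) (mem_univ _) 2
  simp only [preimage_univ, iteratedFDerivWithin_univ] at this
  refine Finset.sum_congr rfl fun i _ => ?_
  have h2 := congrArg (fun l => l ![EuclideanSpace.basisFun (Fin n) ℝ i,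
    EuclideanSpace.basisFun (Fin n) ℝ i]) this
  refine h2.trans ?_
  rw [ContinuousMultilinearMap.compContinuousLinearMap_apply]
  congr 1
  ext j
  fin_cases j <;> rfl

theorem HasFracLapAt.comp_linearIsometryEquiv {n : ℕ} {s : ℝ} {u : E n → ℝ} {x : E n} {L : ℝ}
    (T : E n ≃ₗᵢ[ℝ] E n) (h : HasFracLapAt s u (T x) L) : HasFracLapAt s (u ∘ T) x L := by
  rcases h with ⟨h0, h⟩ | ⟨h0, hc, h⟩ | ⟨h0, hi, h⟩
  · exact Or.inl ⟨h0, h⟩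
  · refine Or.inr (Or.inl ⟨h0, hc.comp x T.contDiff.contDiffAt, ?_⟩)
    rw [laplacian_comp_linearIsometryEquiv T x, h]
  · have hpre : ∀ ε, {y : E n | ε < ‖x - y‖} = T ⁻¹' {y : E n | ε < ‖T x - y‖} := by
      intro ε
      ext y
      simp [← map_sub]
    have hfun : (fun y => ((u ∘ T) x - (u ∘ T) y) / ‖x - y‖ ^ ((n : ℝ) + 2 * s)) =
        (fun y => (u (T x) - u y) / ‖T x - y‖ ^ ((n : ℝ) + 2 * s)) ∘ T := by
      ext y
      simp [← map_sub]
    have hemb : MeasurableEmbedding T := T.toHomeomorph.measurableEmbedding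
    refine Or.inr (Or.inr ⟨h0, fun ε hε => ?_, ?_⟩)
    · rw [hpre, hfun, T.measurePreserving.integrableOn_comp_preimage hemb]
      exact hi ε hε
    · refine h.congr fun ε => ?_
      rw [truncated, truncated, hpre, hfun]
      congr 1
      exact (T.measurePreserving.setIntegral_preimage_emb hemb _ _).symm

theorem HasFracLapAt.of_norm_eq {n : ℕ} {s : ℝ} {U : ℝ → ℝ} {x y : E n} {L : ℝ}
    (h : HasFracLapAt s (radial U) x L) (hxy : ‖y‖ = ‖x‖) : HasFracLapAt s (radial U) y L := by
  -- The reflection exchanging two points of the same sphere leaves every radial function unchanged.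
  set T := (Submodule.span ℝ {y - x})ᗮ.reflection with hT
  have hTy : T y = x := Submodule.reflection_sub hxy
  rw [← hTy] at h
  refine (h.comp_linearIsometryEquiv T).congr_of_eq fun z => ?_
  simp [radial]

/-! ### Differentiating the kernel integral off the support. -/

/-- The derivative of `‖z‖ ^ (-p)` in the direction `v`. -/
noncomputable def kernelDeriv {n : ℕ} (p : ℝ) (z v : E n) : ℝ :=
  -p * ((‖z‖ ^ p)⁻¹ / ‖z‖ ^ 2) * inner ℝ z v

theorem hasDerivAt_kernel {n : ℕ} (p : ℝ) {γ : ℝ → E n} {v : E n} {t : ℝ}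
    (hγ : HasDerivAt γ v t) (h0 : γ t ≠ 0) :
    HasDerivAt (fun t => (‖γ t‖ ^ p)⁻¹) (kernelDeriv p (γ t) v) t := by
  have hK : ∀ z : E n, (‖z‖ ^ p)⁻¹ = (‖z‖ ^ 2) ^ (-(p / 2)) := by
    intro z
    rw [Real.rpow_neg (by positivity), ← Real.rpow_natCast, ← Real.rpow_mul (norm_nonneg z)]
    congr 2
    push_cast; ring
  have hz : ‖γ t‖ ^ 2 ≠ 0 := pow_ne_zero 2 (norm_ne_zero_iff.mpr h0)
  simp only [hK]
  refine (hγ.norm_sq.rpow_const (p := -(p / 2)) (Or.inl hz)).congr_deriv ?_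
  rw [kernelDeriv, hK, Real.rpow_sub_one hz]
  ring

/-- Euler's identity for the `(-p)`-homogeneous kernel. It trades dilation of the integration
variable for dilation of the evaluation point. -/
theorem kernelDeriv_sub_self {n : ℕ} (p : ℝ) {x y : E n} (h : x - y ≠ 0) :
    kernelDeriv p (x - y) (-y) = -p * (‖x - y‖ ^ p)⁻¹ - kernelDeriv p (x - y) x := by
  have h1 : -y = (x - y) - x := by abel
  have hz : ‖x - y‖ ^ 2 ≠ 0 := pow_ne_zero 2 (norm_ne_zero_iff.mpr h)
  rw [kernelDeriv, kernelDeriv, h1, inner_sub_right, real_inner_self_eq_norm_sq]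
  field_simp
  ring

theorem abs_kernelDeriv_le {n : ℕ} {p δ : ℝ} (hp : 0 ≤ p) (hδ : 0 < δ) {z v : E n}
    (hz : δ ≤ ‖z‖) : |kernelDeriv p z v| ≤ p * (‖v‖ / δ) * (‖z‖ ^ p)⁻¹ := by
  have hz0 : 0 < ‖z‖ := hδ.trans_le hz
  have h1 := abs_real_inner_le_norm z v
  have hk : 0 ≤ (‖z‖ ^ p)⁻¹ := by positivity
  rw [kernelDeriv, abs_mul, abs_mul, abs_neg, abs_of_nonneg hp,
    abs_of_nonneg (show 0 ≤ (‖z‖ ^ p)⁻¹ / ‖z‖ ^ 2 by positivity)]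
  calc p * ((‖z‖ ^ p)⁻¹ / ‖z‖ ^ 2) * |inner ℝ z v|
      ≤ p * ((‖z‖ ^ p)⁻¹ / ‖z‖ ^ 2) * (‖z‖ * ‖v‖) := by gcongr
    _ = p * (‖v‖ / ‖z‖) * (‖z‖ ^ p)⁻¹ := by field_simp
    _ ≤ p * (‖v‖ / δ) * (‖z‖ ^ p)⁻¹ := by gcongr

theorem measurable_kernelDeriv {n : ℕ} (p : ℝ) (x v : E n) :
    Measurable fun y : E n => kernelDeriv p (x - y) v := by
  unfold kernelDeriv
  fun_prop

/-- The derivative along a ray of the Riesz-type integral of a function which vanishes near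
the point of evaluation. -/
theorem hasDerivAt_integral_kernel {n : ℕ} (hn : n ≠ 0) {s : ℝ} (hs : 0 < s) {w w' : E n → ℝ}
    (hw : WeightedIntegrable s w) (hw' : WeightedIntegrable s w')
    (hww' : ∀ y ≠ 0, HasDerivAt (fun t : ℝ => w (t • y)) (w' y) 1) {x : E n} {δ : ℝ} (hδ : 0 < δ)
    (h0 : ∀ y, ‖x - y‖ < δ → w y = 0) (h0' : ∀ y, ‖x - y‖ < δ → w' y = 0) :
    HasDerivAt (fun t : ℝ => ∫ y, w y / ‖t • x - y‖ ^ ((n : ℝ) + 2 * s))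
      (∫ y, (-(2 * s) * w y + w' y) / ‖x - y‖ ^ ((n : ℝ) + 2 * s)) 1 := by
  set p : ℝ := (n : ℝ) + 2 * s with hp
  have hp0 : 0 ≤ p := by positivity
  obtain ⟨C, hC0, hC⟩ := inv_norm_sub_rpow_le (n := n) (R := 2 * ‖x‖) hp0 (half_pos hδ)
  -- For `|t - 1| < η` the point `t x` stays at distance at least `δ/2` from the points where `w ≠
  -- 0`, and `|t x| ≤ 2|x|`. The `+ 1` covers `x = 0`.
  set η : ℝ := min 1 (δ / (2 * (‖x‖ + 1))) with hη
  have hη0 : 0 < η := by positivity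
  have hηx : η * ‖x‖ ≤ δ / 2 := by
    calc η * ‖x‖ ≤ δ / (2 * (‖x‖ + 1)) * (‖x‖ + 1) := by
          gcongr
          · exact min_le_right _ _
          · linarith
      _ = δ / 2 := by field_simp
  have hray : ∀ t ∈ Metric.ball (1 : ℝ) η, ∀ y, w y ≠ 0 → δ / 2 ≤ ‖t • x - y‖ := by
    intro t ht y hy
    have h1 : δ ≤ ‖x - y‖ := not_lt.mp fun h => hy (h0 y h)
    have h2 : ‖x - t • x‖ ≤ δ / 2 := by
      have : x - t • x = (1 - t) • x := by rw [sub_smul, one_smul]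
      rw [this, norm_smul]
      refine le_trans ?_ hηx
      rw [Metric.mem_ball, dist_comm, Real.dist_eq] at ht
      gcongr
      exact ht.le
    have h3 : ‖x - y‖ ≤ ‖x - t • x‖ + ‖t • x - y‖ := norm_sub_le_norm_sub_add_norm_sub _ _ _
    linarith
  have hxn : ∀ t ∈ Metric.ball (1 : ℝ) η, ‖t • x‖ ≤ 2 * ‖x‖ := by
    intro t ht
    rw [norm_smul]
    gcongr
    rw [Metric.mem_ball, Real.dist_eq] at ht
    have h1 : |t - 1| ≤ 1 := ht.le.trans (min_le_left _ _)
    have := abs_le.mp h1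
    rw [Real.norm_eq_abs, abs_le]
    constructor <;> linarith
  have h1mem : (1 : ℝ) ∈ Metric.ball (1 : ℝ) η := Metric.mem_ball_self hη0
  have hKm : ∀ z : E n, Measurable fun y : E n => (‖z - y‖ ^ p)⁻¹ := fun z => by fun_prop
  have hkb : ∀ t ∈ Metric.ball (1 : ℝ) η, ∀ y, w y ≠ 0 →
      |(‖t • x - y‖ ^ p)⁻¹| ≤ C * ((1 + ‖y‖ ^ 2) ^ (p / 2))⁻¹ := by
    intro t ht y hy
    rw [abs_of_nonneg (by positivity)]
    exact hC _ y (hxn t ht) (hray t ht y hy)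
  have hdb : ∀ t ∈ Metric.ball (1 : ℝ) η, ∀ y, w y ≠ 0 →
      |kernelDeriv p (t • x - y) x| ≤
        (p * (‖x‖ / (δ / 2)) * C) * ((1 + ‖y‖ ^ 2) ^ (p / 2))⁻¹ := by
    intro t ht y hy
    refine (abs_kernelDeriv_le hp0 (half_pos hδ) (hray t ht y hy)).trans ?_
    rw [mul_assoc _ C]
    gcongr
    exact hC _ y (hxn t ht) (hray t ht y hy)
  have hint : ∀ t ∈ Metric.ball (1 : ℝ) η, Integrable fun y => w y * (‖t • x - y‖ ^ p)⁻¹ :=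
    fun t ht => hw.integrable_mul (hKm _).aestronglyMeasurable
      (Eventually.of_forall (hkb t ht))
  have hint1 : Integrable fun y => w y * (‖x - y‖ ^ p)⁻¹ := by simpa using hint 1 h1mem
  have hint' : Integrable fun y => w' y * (‖x - y‖ ^ p)⁻¹ := by
    refine hw'.integrable_mul (C := C) (hKm x).aestronglyMeasurable
      (Eventually.of_forall fun y hy => ?_)
    have h1 : δ ≤ ‖x - y‖ := not_lt.mp fun h => hy (h0' y h)
    rw [abs_of_nonneg (by positivity)]
    exact hC _ y (by linarith [norm_nonneg x]) (by linarith)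
  have hwm : AEStronglyMeasurable w := hw.aestronglyMeasurable_fun
  have hdiff := hasDerivAt_integral_of_dominated_loc_of_deriv_le
    (μ := (volume : Measure (E n))) (x₀ := (1 : ℝ))
    (F := fun t y => w y * (‖t • x - y‖ ^ p)⁻¹)
    (F' := fun t y => w y * kernelDeriv p (t • x - y) x)
    (bound := fun y => (p * (‖x‖ / (δ / 2)) * C) * ‖w y / (1 + ‖y‖ ^ 2) ^ (p / 2)‖)
    (Metric.ball_mem_nhds 1 hη0)
    (Eventually.of_forall fun t => hwm.mul (hKm _).aestronglyMeasurable) (hint 1 h1mem)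
    (hwm.mul (measurable_kernelDeriv p _ _).aestronglyMeasurable) ?_ (hw.norm.const_mul _) ?_
  · obtain ⟨hdi, hd⟩ := hdiff
    simp only [one_smul] at hdi hd
    have hI : Integrable fun y =>
        -p * (w y * (‖x - y‖ ^ p)⁻¹) - w y * kernelDeriv p (x - y) x :=
      (hint1.const_mul _).sub hdi
    -- Integration by parts: the factor `-n` and the homogeneity `-p` combine to `n - p = -2s`.
    have key := integral_euler hn (f := fun y => w y * (‖x - y‖ ^ p)⁻¹)
      (f' := fun y => w' y * (‖x - y‖ ^ p)⁻¹ +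
        (-p * (w y * (‖x - y‖ ^ p)⁻¹) - w y * kernelDeriv p (x - y) x))
      hint1 (hint'.add hI) ?_
    · rw [integral_add hint' hI, integral_sub (hint1.const_mul _) hdi,
        integral_const_mul] at key
      have hval : ∫ y, (-(2 * s) * w y + w' y) / ‖x - y‖ ^ p =
          -(2 * s) * (∫ y, w y * (‖x - y‖ ^ p)⁻¹) + ∫ y, w' y * (‖x - y‖ ^ p)⁻¹ := by
        rw [← integral_const_mul, ← integral_add (hint1.const_mul _) hint']
        congr 1
        ext y
        ring
      simp only [div_eq_mul_inv] at hval ⊢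
      rw [hval]
      refine hd.congr_deriv ?_
      rw [hp] at key ⊢
      linarith
    · intro y hy
      by_cases hxy : ‖x - y‖ < δ
      · have hz : (fun t : ℝ => w (t • y) * (‖x - t • y‖ ^ p)⁻¹) =ᶠ[𝓝 1] fun _ => 0 := by
          have hc : Tendsto (fun t : ℝ => ‖x - t • y‖) (𝓝 1) (𝓝 ‖x - y‖) := by
            have : Continuous fun t : ℝ => ‖x - t • y‖ := by fun_prop
            simpa using this.tendsto 1
          filter_upwards [hc.eventually_lt_const hxy] with t ht
          rw [h0 _ ht, zero_mul]
        refine ((hasDerivAt_const (1 : ℝ) (0 : ℝ)).congr_of_eventuallyEq hz).congr_deriv ?_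
        rw [h0 _ hxy, h0' _ hxy]
        ring
      · have hne : x - y ≠ 0 := norm_pos_iff.mp (hδ.trans_le (not_lt.mp hxy))
        have h1 := hasDerivAt_kernel p ((hasDerivAt_smul_const y 1).const_sub x) (by simpa using hne)
        refine ((hww' y hy).mul h1).congr_deriv ?_
        simp only [one_smul]
        rw [kernelDeriv_sub_self p hne]
        ring
  · refine Eventually.of_forall fun y t ht => ?_
    by_cases hy : w y = 0
    · simp [hy]
    rw [norm_mul, norm_div, Real.norm_eq_abs (kernelDeriv _ _ _),
      Real.norm_of_nonneg (by positivity : 0 ≤ (1 + ‖y‖ ^ 2) ^ (p / 2)), div_eq_mul_inv]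
    refine (mul_le_mul_of_nonneg_left (hdb t ht y hy) (norm_nonneg _)).trans_eq ?_
    ring
  · refine Eventually.of_forall fun y t ht => ?_
    by_cases hy : w y = 0
    · simpa [hy] using hasDerivAt_const t (0 : ℝ)
    refine (hasDerivAt_kernel p ((hasDerivAt_smul_const x t).sub_const y) ?_).const_mul (w y)
    exact norm_pos_iff.mp ((half_pos hδ).trans_le (hray t ht y hy))

/-! ### Radial functions and the pointwise formula. -/

theorem contDiffAt_radial {n : ℕ} {G : ℝ → ℝ} {k : ℕ∞ω} {x : E n} (hx : x ≠ 0)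
    (hG : ContDiffAt ℝ k G ‖x‖) : ContDiffAt ℝ k (radial G) x :=
  hG.comp x (contDiffAt_norm ℝ hx)

theorem hasDerivAt_radial_ray {n : ℕ} {G : ℝ → ℝ} {x : E n} (hG : DifferentiableAt ℝ G ‖x‖) :
    HasDerivAt (fun t : ℝ => radial G (t • x)) (‖x‖ * deriv G ‖x‖) 1 := by
  have h1 : HasDerivAt (fun t : ℝ => t * ‖x‖) ‖x‖ 1 := by
    simpa using (hasDerivAt_id (1 : ℝ)).mul_const ‖x‖
  have h2 : HasDerivAt G (deriv G ‖x‖) (1 * ‖x‖) := by rw [one_mul]; exact hG.hasDerivAt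
  have h3 := HasDerivAt.comp (h := fun t : ℝ => t * ‖x‖) 1 h2 h1
  refine (h3.congr_deriv (mul_comm _ _)).congr_of_eventuallyEq ?_
  filter_upwards [Ioi_mem_nhds one_pos] with t ht
  simp [radial, norm_smul, abs_of_pos (show (0 : ℝ) < t from ht)]

theorem euler_radial {n : ℕ} {G : ℝ → ℝ} {x : E n} (hx : x ≠ 0)
    (hG : ContDiffAt ℝ 1 G ‖x‖) : euler (radial G) x = ‖x‖ * deriv G ‖x‖ := by
  have h1 : DifferentiableAt ℝ (radial G) ((1 : ℝ) • x) := by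
    rw [one_smul]
    exact (contDiffAt_radial hx hG).differentiableAt one_ne_zero
  have h2 := hasDerivAt_comp_smul h1 one_ne_zero
  have h3 := h2.unique (hasDerivAt_radial_ray (hG.differentiableAt one_ne_zero))
  simpa using h3

/-- A compactly supported function of class `C³` agreeing with a radial function
near a given sphere. -/
theorem exists_local_radial {n : ℕ} {U : ℝ → ℝ} {r : ℝ} (hr : 0 < r) (hU : ContDiffAt ℝ 3 U r) :
    ∃ (g : E n → ℝ) (δ : ℝ), ContDiff ℝ 3 g ∧ HasCompactSupport g ∧ 0 < δ ∧
      ∀ y : E n, |‖y‖ - r| < δ → g y = radial U y := by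
  obtain ⟨δ, hδ, hball⟩ := Metric.eventually_nhds_iff.mp
    ((hU.eventually (by simp)).and (lt_mem_nhds hr))
  -- The cutoff dies at `δ/2`, strictly inside the shell of width `δ` where `U` is `C³` and `|x| >
  -- 0`, so the product is `C³` everywhere.
  let ψ : ContDiffBump r := ⟨δ / 4, δ / 2, by positivity, by linarith⟩
  refine ⟨radial fun ρ => ψ ρ * U ρ, δ / 4, ?_, ?_, by positivity, ?_⟩
  · rw [contDiff_iff_contDiffAt]
    intro x
    by_cases hx : dist ‖x‖ r < δ
    · obtain ⟨h1, h2⟩ := hball hx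
      exact contDiffAt_radial (norm_pos_iff.mp h2) (ψ.contDiff.contDiffAt.mul h1)
    · have hx' : δ / 2 < dist ‖x‖ r := by linarith [not_lt.mp hx]
      refine (contDiffAt_const (c := (0 : ℝ))).congr_of_eventuallyEq ?_
      have hc : Tendsto (fun y : E n => dist ‖y‖ r) (𝓝 x) (𝓝 (dist ‖x‖ r)) :=
        (continuous_norm.dist continuous_const).tendsto x
      filter_upwards [hc.eventually_const_lt hx'] with y hy
      simp [radial, ψ.zero_of_le_dist hy.le]
  · refine HasCompactSupport.intro (isCompact_closedBall (0 : E n) (r + δ / 2)) fun x hx => ?_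
    rw [mem_closedBall_zero_iff, not_le] at hx
    have : δ / 2 ≤ dist ‖x‖ r := by
      rw [Real.dist_eq]
      exact le_trans (by linarith) (le_abs_self _)
    simp [radial, ψ.zero_of_le_dist this]
  · intro y hy
    have : ψ ‖y‖ = 1 := ψ.one_of_mem_closedBall (by
      rw [Metric.mem_closedBall, Real.dist_eq]; exact hy.le)
    simp [radial, this]

/-- The formula at a point, for `0 < s < 1`. -/
theorem hasDerivAt_fracLap_radial_of_lt {n : ℕ} (hn : n ≠ 0) {s : ℝ} (hs : 0 < s) (hs1 : s < 1)
    {U : ℝ → ℝ} {v : E n → ℝ} (hu : WeightedIntegrable s (radial U : E n → ℝ))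
    (hv : WeightedIntegrable s v)
    (huv : ∀ x ≠ 0, HasDerivAt (fun t : ℝ => radial U (t • x)) (v x + 2 * s * radial U x) 1)
    {x : E n} (hx : x ≠ 0) (hU : ContDiffAt ℝ 3 U ‖x‖) :
    (∀ᶠ z in 𝓝 x, HasFracLapAt s (radial U) z (fracLap s (radial U) z)) ∧
      HasFracLapAt s v x (fracLap s v x) ∧
      HasDerivAt (fun t : ℝ => fracLap s (radial U) (t • x)) (fracLap s v x) 1 := by
  obtain ⟨g, δ₀, hg, hgc, hδ₀, hgU⟩ := exists_local_radial (n := n) (norm_pos_iff.mpr hx) hU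
  -- Taking `δ ≤ ‖x‖` keeps the ball around `x` away from the origin, where no ray derivative is
  -- assumed.
  set δ : ℝ := min δ₀ ‖x‖
  have hδ : 0 < δ := lt_min hδ₀ (norm_pos_iff.mpr hx)
  set u : E n → ℝ := radial U with hudef
  have hsI : s ∈ Icc (0 : ℝ) 1 := ⟨hs.le, hs1.le⟩
  have hg2 : ContDiff ℝ 2 g := hg.of_le (by norm_num)
  have he : ContDiff ℝ 2 (euler g) := contDiff_euler hg (by norm_num)
  have hec := hasCompactSupport_euler hgc
  set w : E n → ℝ := fun y => u y + -1 * g y with hw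
  set w' : E n → ℝ := fun y => (v y + 2 * s * u y) + -1 * euler g y with hw'
  have hwi : WeightedIntegrable s w :=
    hu.add ((weightedIntegrable_of_compact hg.continuous hgc).const_mul _)
  have hwi' : WeightedIntegrable s w' :=
    (hv.add (hu.const_mul _)).add ((weightedIntegrable_of_compact he.continuous hec).const_mul _)
  have hww' : ∀ y ≠ 0, HasDerivAt (fun t : ℝ => w (t • y)) (w' y) 1 := by
    intro y hy
    have h1 := hasDerivAt_comp_smul (x := y) (hg.differentiable (by norm_num) ((1 : ℝ) • y))
      one_ne_zero
    refine ((huv y hy).add (h1.const_mul (-1))).congr_deriv ?_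
    simp [hw']
  have hnear : ∀ y, ‖x - y‖ < δ → w =ᶠ[𝓝 y] 0 := by
    intro y hy
    have hc : Tendsto (fun z : E n => ‖x - z‖) (𝓝 y) (𝓝 ‖x - y‖) := by
      have : Continuous fun z : E n => ‖x - z‖ := by fun_prop
      exact this.tendsto y
    filter_upwards [hc.eventually_lt_const hy] with z hz
    have : |‖z‖ - ‖x‖| < δ₀ := by
      rw [abs_sub_comm]
      exact (abs_norm_sub_norm_le x z).trans_lt (hz.trans_le (min_le_left _ _))
    simp [hw, hgU z this, hudef]
  have h0 : ∀ y, ‖x - y‖ < δ → w y = 0 := fun y hy => (hnear y hy).self_of_nhds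
  have h0' : ∀ y, ‖x - y‖ < δ → w' y = 0 := by
    intro y hy
    have hy0 : y ≠ 0 := by
      rintro rfl
      rw [sub_zero] at hy
      exact absurd (hy.trans_le (min_le_right _ _)) (lt_irrefl _)
    have hc : Tendsto (fun t : ℝ => t • y) (𝓝 1) (𝓝 y) := by
      have : Continuous fun t : ℝ => t • y := by fun_prop
      simpa using this.tendsto 1
    exact (hww' y hy0).unique
      ((hasDerivAt_const (1 : ℝ) (0 : ℝ)).congr_of_eventuallyEq (hc.eventually (hnear y hy)))
  have hball : ∀ᶠ z in 𝓝 x, ‖x - z‖ < δ := by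
    filter_upwards [Metric.ball_mem_nhds x hδ] with z hz
    rwa [Metric.mem_ball, dist_comm, dist_eq_norm] at hz
  have hu_at : ∀ z, ‖x - z‖ < δ → HasFracLapAt s u z (fracLap s g z +
      -normConst s n * ∫ y, w y / ‖z - y‖ ^ ((n : ℝ) + 2 * s)) := by
    intro z hz
    refine ((hasFracLapAt_fracLap hn hsI hg2 hgc z).add
      (hasFracLapAt_of_vanishing hs hs1 hwi (hnear z hz))).congr_of_eq fun y => ?_
    simp [hw]
  -- This uses `v = (-2s g + x·∇g) + (-2s w + w')`, whose second bracket vanishes near `x`.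
  have hv_at : HasFracLapAt s v x ((-(2 * s) * fracLap s g x + fracLap s (euler g) x) +
      -normConst s n * ∫ y, (-(2 * s) * w y + w' y) / ‖x - y‖ ^ ((n : ℝ) + 2 * s)) := by
    have hvan : (fun y => -(2 * s) * w y + w' y) =ᶠ[𝓝 x] 0 := by
      filter_upwards [hball] with z hz
      simp [h0 z hz, h0' z hz]
    refine ((((hasFracLapAt_fracLap hn hsI hg2 hgc x).const_mul (-(2 * s))).add
      (hasFracLapAt_fracLap hn hsI he hec x)).add
      (hasFracLapAt_of_vanishing hs hs1 ((hwi.const_mul _).add hwi') hvan)).congr_of_eq fun y => ?_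
    simp only [hw, hw']
    ring
  refine ⟨?_, ?_, ?_⟩
  · filter_upwards [hball] with z hz
    have := hu_at z hz
    rwa [this.fracLap_eq]
  · rwa [hv_at.fracLap_eq]
  · rw [hv_at.fracLap_eq]
    have hd := (hasDerivAt_fracLap_ray hn hsI hg hgc x).add
      ((hasDerivAt_integral_kernel hn hs hwi hwi' hww' hδ h0 h0').const_mul (-normConst s n))
    refine (hd.congr_deriv (by ring)).congr_of_eventuallyEq ?_
    have hc : Tendsto (fun t : ℝ => t • x) (𝓝 1) (𝓝 x) := by
      have : Continuous fun t : ℝ => t • x := by fun_prop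
      simpa using this.tendsto 1
    filter_upwards [hc.eventually hball] with t ht
    exact (hu_at _ ht).fracLap_eq

/-- The formula at a point, for `s = 1`. -/
theorem hasDerivAt_fracLap_radial_one {n : ℕ} {U : ℝ → ℝ} {v : E n → ℝ}
    (hv : v = radial fun r => -2 * 1 * U r + r * deriv U r)
    {x : E n} (hx : x ≠ 0) (hU : ContDiffAt ℝ 3 U ‖x‖) :
    (∀ᶠ z in 𝓝 x, HasFracLapAt 1 (radial U) z (fracLap 1 (radial U) z)) ∧
      HasFracLapAt 1 v x (fracLap 1 v x) ∧
      HasDerivAt (fun t : ℝ => fracLap 1 (radial U) (t • x)) (fracLap 1 v x) 1 := by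
  set u : E n → ℝ := radial U with hudef
  have hev : ∀ᶠ z in 𝓝 x, z ≠ 0 ∧ ContDiffAt ℝ 3 U ‖z‖ :=
    (isOpen_ne.eventually_mem hx).and (continuous_norm.continuousAt.eventually (hU.eventually (by simp)))
  have hu3 : ContDiffAt ℝ 3 u x := contDiffAt_radial hx hU
  have he2 : ContDiffAt ℝ 2 (euler u) x :=
    (hu3.fderiv_right (m := 2) (by norm_num)).clm_apply contDiffAt_id
  have hu2 : ContDiffAt ℝ 2 u x := hu3.of_le (by norm_num)
  have hu_at : ∀ᶠ z in 𝓝 x, HasFracLapAt 1 u z (-Laplacian.laplacian u z) := by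
    filter_upwards [hev] with z hz
    exact Or.inr (Or.inl ⟨rfl, (contDiffAt_radial hz.1 hz.2).of_le (by norm_num), rfl⟩)
  have hveq : v =ᶠ[𝓝 x] fun y => -2 * u y + euler u y := by
    filter_upwards [hev] with z hz
    rw [euler_radial hz.1 (hz.2.of_le (by norm_num)), hv]
    simp [radial, hudef]
  have hsum : HasFracLapAt 1 (fun y => -2 * u y + euler u y) x
      (-2 * -Laplacian.laplacian u x + -Laplacian.laplacian (euler u) x) :=
    HasFracLapAt.add (HasFracLapAt.const_mul (-2) (Or.inr (Or.inl ⟨rfl, hu2, rfl⟩)))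
      (Or.inr (Or.inl ⟨rfl, he2, rfl⟩))
  have hv_at : HasFracLapAt 1 v x
      (-2 * -Laplacian.laplacian u x + -Laplacian.laplacian (euler u) x) := by
    rcases hsum with ⟨h, -⟩ | ⟨-, hc, h⟩ | ⟨h, -⟩
    · exact absurd h one_ne_zero
    · refine Or.inr (Or.inl ⟨rfl, hc.congr_of_eventuallyEq hveq, ?_⟩)
      rw [h, (InnerProductSpace.laplacian_congr_nhds hveq).self_of_nhds]
    · exact absurd h.2 (lt_irrefl _)
  refine ⟨?_, ?_, ?_⟩
  · filter_upwards [hu_at] with z hz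
    rwa [hz.fracLap_eq]
  · rwa [hv_at.fracLap_eq]
  · rw [hv_at.fracLap_eq]
    refine ((hasDerivAt_laplacian_ray hu3).neg.congr_deriv (by ring)).congr_of_eventuallyEq ?_
    have hc : Tendsto (fun t : ℝ => t • x) (𝓝 1) (𝓝 x) := by
      have : Continuous fun t : ℝ => t • x := by fun_prop
      simpa using this.tendsto 1
    filter_upwards [hc.eventually hu_at] with t ht
    exact ht.fracLap_eq

end FracLap

/-! ### Assembly. -/

theorem mainTheorem8 (n : ℕ) (hn : 2 ≤ n) (s : ℝ) (hs : s ∈ Set.Icc (0 : ℝ) 1)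
    (U : ℝ → ℝ) (hU : DifferentiableOn ℝ U (Set.Ioi 0))
    (u v : FracLap.E n → ℝ)
    (hu : u = FracLap.radial U)
    (hv : v = FracLap.radial (fun r => -2 * s * U r + r * deriv U r))
    (hu_int : FracLap.WeightedIntegrable s u)
    (hv_int : FracLap.WeightedIntegrable s v) :
    -- the formula in the sense of distributions on `ℝⁿ \ {0}`
    (FracLap.DistFracLapDefined s u ∧ FracLap.DistFracLapDefined s v ∧
      ∀ h : FracLap.E n → ℝ, FracLap.IsTest {0}ᶜ h →
        FracLap.distRadialDeriv (FracLap.distFracLap s u) h =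
          FracLap.distDivRadius (FracLap.distFracLap s v) h) ∧
    -- the formula pointwise, at every radius near which `U` is `C³` (at every radius if `s = 0`)
    (∀ r : ℝ, 0 < r → (s = 0 ∨ ContDiffAt ℝ 3 U r) →
      ∃ (f : ℝ → ℝ) (L : ℝ),
        (∀ᶠ ρ in nhds r, ∀ x : FracLap.E n, ‖x‖ = ρ → FracLap.HasFracLapAt s u x (f ρ)) ∧
        (∀ x : FracLap.E n, ‖x‖ = r → FracLap.HasFracLapAt s v x L) ∧
        HasDerivAt f (1 / r * L) r) := by
  have hn0 : n ≠ 0 := by omega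
  have hUd : ∀ r : ℝ, 0 < r → DifferentiableAt ℝ U r := fun r hr =>
    hU.differentiableAt (Ioi_mem_nhds hr)
  have huv : ∀ x : FracLap.E n, x ≠ 0 →
      HasDerivAt (fun t : ℝ => u (t • x)) (v x + 2 * s * u x) 1 := by
    intro x hx
    rw [hu, hv]
    refine (FracLap.hasDerivAt_radial_ray (hUd _ (norm_pos_iff.mpr hx))).congr_deriv ?_
    simp only [FracLap.radial]
    ring
  refine ⟨⟨fun h hh => ?_, fun h hh => ?_, fun h hh =>
    FracLap.distRadialDeriv_distFracLap hn0 hs hu_int hv_int huv hh⟩, fun r hr hsr => ?_⟩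
  · exact hu_int.integrable_mul_fracLap hn0 hs (by exact_mod_cast contDiff_infty.mp hh.1 2) hh.2.1
  · exact hv_int.integrable_mul_fracLap hn0 hs (by exact_mod_cast contDiff_infty.mp hh.1 2) hh.2.1
  rcases eq_or_ne s 0 with rfl | hs0
  · refine ⟨U, r * deriv U r, ?_, fun x hx => Or.inl ⟨rfl, ?_⟩, ?_⟩
    · exact Filter.Eventually.of_forall fun ρ x hx => Or.inl ⟨rfl, by rw [hu, ← hx]; rfl⟩
    · rw [hv, ← hx]
      simp [FracLap.radial]
    · refine (hUd r hr).hasDerivAt.congr_deriv ?_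
      field_simp
  have hU3 : ContDiffAt ℝ 3 U r := hsr.resolve_left hs0
  have hs_pos : 0 < s := lt_of_le_of_ne hs.1 hs0.symm
  -- One fixed direction suffices; reflections carry the values to the rest of each sphere.
  let e : FracLap.E n := EuclideanSpace.single ⟨0, by omega⟩ 1
  have he : ‖e‖ = 1 := by simp [e]
  have hre : ‖r • e‖ = r := by rw [norm_smul, he, mul_one, Real.norm_of_nonneg hr.le]
  have hx : r • e ≠ 0 := by rw [← norm_pos_iff, hre]; exact hr
  have main : (∀ᶠ z in nhds (r • e), FracLap.HasFracLapAt s u z (FracLap.fracLap s u z)) ∧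
      FracLap.HasFracLapAt s v (r • e) (FracLap.fracLap s v (r • e)) ∧
      HasDerivAt (fun t : ℝ => FracLap.fracLap s u (t • r • e)) (FracLap.fracLap s v (r • e)) 1 := by
    rcases hs.2.eq_or_lt with rfl | hs1
    · rw [hu]
      exact FracLap.hasDerivAt_fracLap_radial_one hv hx (hre.symm ▸ hU3)
    · subst hu
      exact FracLap.hasDerivAt_fracLap_radial_of_lt hn0 hs_pos hs1 hu_int hv_int huv hx
        (hre.symm ▸ hU3)
  obtain ⟨hu_ev, hv_at, hder⟩ := main
  refine ⟨fun ρ => FracLap.fracLap s u (ρ • e), FracLap.fracLap s v (r • e), ?_, ?_, ?_⟩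
  · have hc : Filter.Tendsto (fun ρ : ℝ => ρ • e) (nhds r) (nhds (r • e)) := by
      have : Continuous fun ρ : ℝ => ρ • e := by fun_prop
      exact this.tendsto r
    filter_upwards [hc.eventually hu_ev, Ioi_mem_nhds hr] with ρ hρ hρ0 x hxρ
    subst hu
    refine hρ.of_norm_eq ?_
    rw [norm_smul, he, mul_one, Real.norm_of_nonneg (le_of_lt hρ0), hxρ]
  · intro x hxr
    subst hv
    exact hv_at.of_norm_eq (hxr.trans hre.symm)
  -- The substitution `t = ρ/r` turns the ray derivative at `1` into `d/dρ` at `r` and yields the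
  -- factor `1/r`.
  · have hder' : HasDerivAt (fun t : ℝ => FracLap.fracLap s u (t • r • e))
        (FracLap.fracLap s v (r • e)) (r / r) := by rwa [div_self hr.ne']
    have h1 : HasDerivAt (fun ρ : ℝ => ρ / r) (1 / r) r := (hasDerivAt_id r).div_const r
    have h2 := HasDerivAt.comp (h := fun ρ : ℝ => ρ / r) r hder' h1
    refine (h2.congr_deriv (mul_comm _ _)).congr_of_eventuallyEq
      (Filter.Eventually.of_forall fun ρ => ?_)
    simp [smul_smul, div_mul_cancel₀ ρ hr.ne']
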